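/- For each $n \ge 1$ let $G_n=(V_n,E_n)$ be the $n$-dimensional hypercube: $V_n=\{0,1\}^n$, and $E_n$ is the set of (undirected) edges joining two vertices that differ in exactly one coordinate. Let $(\xi_e)_{e\in E_n}$ be independent, identically distributed exponential random variables with mean one. Let $\Pi_n$ be the set of the $n!$ paths $\mathbf 0=v_0,v_1,\dots,v_n=\mathbf 1$ of length $n$ in $G_n$ from $\mathbf 0=(0,\dots,0)$ to $\mathbf 1=(1,\dots,1)$, let $X_\pi=\sum_{j=1}^n \xi_{\{v_{j-1},v_j\}}$ be the weight of $\pi\in\Pi_n$, and let $m_n=\min_{\pi\in\Pi_n}X_\pi$. Then $m_n\to 1$ in probability as $n\to\infty$, that is, for every $\varepsilon>0$, $$\lim_{n\to\infty}\mathbb P\left(|m_n-1|\ge\varepsilon\right)=0.$$ -/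

import Mathlib

open MeasureTheory ProbabilityTheory Filter Topology

namespace Hypercube

/-- The vertex set `{0,1}^n` of the `n`-dimensional hypercube. -/
abbrev Vertex (n : ℕ) : Type := Fin n → Bool

/-- The `n`-dimensional hypercube: edges join the vertices that differ in exactly one coordinate. -/
def graph (n : ℕ) : SimpleGraph (Vertex n) where
  Adj x y := hammingDist x y = 1
  symm := ⟨fun x y h => by rw [hammingDist_comm]; exact h⟩
  loopless := ⟨fun x h => by simp at h⟩

instance (n : ℕ) : DecidableRel (graph n).Adj :=
  fun x y => inferInstanceAs (Decidable (hammingDist x y = 1))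

/-- The paths `0 = v_0, v_1, …, v_n = 1` of length `n` in the hypercube. (As `0` and `1` are at
distance `n`, every step of such a path changes a coordinate from `0` to `1`.) -/
abbrev OrientedPath (n : ℕ) : Type :=
  {v : Fin (n + 1) → Vertex n //
    v 0 = (fun _ => false) ∧ v (Fin.last n) = (fun _ => true) ∧
      ∀ i : Fin n, (graph n).Adj (v i.castSucc) (v i.succ)}

/-- The edge traversed by the path `p` in the step from `v_i` to `v_{i+1}`. -/
def OrientedPath.edge {n : ℕ} (p : OrientedPath n) (i : Fin n) : (graph n).edgeSet :=
  ⟨s(p.1 i.castSucc, p.1 i.succ), (SimpleGraph.mem_edgeSet _).2 (p.2.2.2 i)⟩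

instance (n : ℕ) : Nonempty (OrientedPath n) := by
  refine ⟨⟨fun i j => decide (j.val < i.val), ?_, ?_, ?_⟩⟩
  · funext j; simp
  · funext j; simp
  · intro i
    change hammingDist _ _ = 1
    rw [hammingDist, Finset.card_eq_one]
    refine ⟨i, ?_⟩
    ext j
    simp only [Finset.mem_filter, Finset.mem_univ, true_and, Finset.mem_singleton, ne_eq,
      decide_eq_decide, Fin.val_castSucc, Fin.val_succ, Fin.ext_iff]
    omega

/-- The weight of a path: the sum of the weights `w e` of its edges. -/
def pathWeight {n : ℕ} (w : (graph n).edgeSet → ℝ) (p : OrientedPath n) : ℝ :=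
  ∑ i : Fin n, w (p.edge i)

/-- The minimal weight of a path of length `n` from `0` to `1`, for the edge weights `w`. -/
noncomputable def minWeight {n : ℕ} (w : (graph n).edgeSet → ℝ) : ℝ :=
  Finset.univ.inf' Finset.univ_nonempty (fun p : OrientedPath n => pathWeight w p)

end Hypercube

/-! There are `n!` paths, each a sum of `n` independent exponentials, so the expected number of
paths of weight at most `t` is `t ^ n` up to a factor polynomial in `n`. For `t < 1` this tends to
`0`, and the union bound gives the lower half of the theorem (`expPi_real_minWeight_le`).

For `t = 1 + δ` the second moment is used. Paths correspond to permutations, and the edges shared by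
the paths of `σ` and `τ` sit at cuts of `σ⁻¹ * τ`. At most about `(n - k)! (1 + δ) ^ k` permutations
have `k` cuts (`exists_card_permsWithCuts_le`), while for a pair sharing `k` edges the power of `t`
in the joint bound drops from `t ^ (2 * n)` to `t ^ (2 * n - k)`. With `t = 1 + δ` the two effects
cancel, so the second moment is within a polynomial factor of the squared first moment. This yields
only a probability of at least `c / (n + 1) ^ 5` (`exists_expPi_real_minWeight_ge`).

That probability is then amplified. Two coordinates of the `(n + 2)`-cube determine two disjoint
`n`-subcubes (values `10` and `01`), each entered by one edge at `0` and left by one edge at `1`.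
Among the many disjoint pairs of coordinates, one very likely has all four of these edges cheap, and
then both subcubes must fail for the large cube to fail. So the failure probability is essentially
squared (`tailProb_add_two_le`). Iterating about `N ^ (1/8)` times, at a total cost of `ε / 2` in
weight, sends it to `0` (`tendsto_tailProb`). -/

namespace Hypercube

open scoped ENNReal

/-! ### Counting permutations by their number of cuts. -/

/-- `i` is a cut of `ρ` if `ρ` preserves both `{j | j < i}` and `{j | j ≤ i}`. -/
def IsCut {n : ℕ} (ρ : Equiv.Perm (Fin n)) (i : Fin n) : Prop :=
  (∀ j, ρ j < i ↔ j < i) ∧ ∀ j, ρ j ≤ i ↔ j ≤ i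

instance {n : ℕ} (ρ : Equiv.Perm (Fin n)) : DecidablePred (IsCut ρ) :=
  fun i => inferInstanceAs (Decidable ((∀ j, ρ j < i ↔ j < i) ∧ ∀ j, ρ j ≤ i ↔ j ≤ i))

/-- The cuts of `ρ` from position `a` on. -/
def cutsFrom {n : ℕ} (ρ : Equiv.Perm (Fin n)) (a : ℕ) : Finset (Fin n) :=
  Finset.univ.filter fun i => a ≤ i.val ∧ IsCut ρ i

/-- The permutations that fix `{j | j < a}` pointwise and have exactly `k` cuts from `a` on. -/
def permsWithCuts (n a k : ℕ) : Finset (Equiv.Perm (Fin n)) :=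
  Finset.univ.filter fun ρ => (∀ j : Fin n, j.val < a → ρ j = j) ∧ (cutsFrom ρ a).card = k

/-- The permutations that move only elements of `{j | a ≤ j < b}`. -/
def permsSupportedIn (n a b : ℕ) : Finset (Equiv.Perm (Fin n)) :=
  Finset.univ.filter fun ρ => ∀ j : Fin n, ¬ (a ≤ j.val ∧ j.val < b) → ρ j = j

lemma card_filter_between_le (n a b : ℕ) :
    (Finset.univ.filter fun j : Fin n => a ≤ j.val ∧ j.val < b).card ≤ b - a := by
  rw [← Nat.card_Ico, ← Finset.card_map Fin.valEmbedding]
  apply Finset.card_le_card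
  intro x hx
  simp only [Finset.mem_map, Finset.mem_filter, Finset.mem_univ, true_and] at hx
  obtain ⟨j, hj, rfl⟩ := hx
  simpa using hj

lemma card_permsSupportedIn_le (n a b : ℕ) :
    (permsSupportedIn n a b).card ≤ (b - a).factorial := by
  let p : Fin n → Prop := fun j => a ≤ j.val ∧ j.val < b
  have h1 : (permsSupportedIn n a b).card
      = Fintype.card {f : Equiv.Perm (Fin n) // ∀ j, ¬ p j → f j = j} := by
    rw [Fintype.card_subtype]; rfl
  rw [h1, ← Fintype.card_congr (Equiv.Perm.subtypeEquivSubtypePerm p), Fintype.card_perm,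
    Fintype.card_subtype]
  exact Nat.factorial_le (card_filter_between_le n a b)

lemma permsWithCuts_zero_subset (n a : ℕ) : permsWithCuts n a 0 ⊆ permsSupportedIn n a n := by
  intro ρ hρ
  simp only [permsWithCuts, permsSupportedIn, Finset.mem_filter, Finset.mem_univ, true_and]
    at hρ ⊢
  intro j hj
  refine hρ.1 j ?_
  have := j.isLt
  omega

/-- A permutation factors at each of its cuts. -/
lemma IsCut.exists_factor {n : ℕ} {ρ : Equiv.Perm (Fin n)} {a : ℕ} {i : Fin n}
    (hfix : ∀ j : Fin n, j.val < a → ρ j = j) (hi : IsCut ρ i) :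
    ∃ α ∈ permsSupportedIn n a i, ∃ β : Equiv.Perm (Fin n), ρ = α * β ∧
      (∀ j, j ≤ i → β j = j) ∧ ∀ j, i < j → β j = ρ j := by
  have hρi : ρ i = i := by
    have h1 := (hi.2 i).2 le_rfl
    have h2 := mt (hi.1 i).1 (lt_irrefl i)
    exact le_antisymm h1 (not_lt.1 h2)
  have hp : ∀ j, ρ j < i ↔ j < i := hi.1
  let α : Equiv.Perm (Fin n) := Equiv.Perm.ofSubtype (ρ.subtypePerm (p := fun j => j < i) hp)
  have hα1 : ∀ j, j < i → α j = ρ j := fun j hj => by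
    simp only [α]
    rw [Equiv.Perm.ofSubtype_apply_of_mem (ρ.subtypePerm (p := fun j => j < i) hp) hj]
    rfl
  have hα2 : ∀ j, ¬ j < i → α j = j := fun j hj => by
    simp only [α]
    rw [Equiv.Perm.ofSubtype_apply_of_not_mem (ρ.subtypePerm (p := fun j => j < i) hp) hj]
  refine ⟨α, ?_, α⁻¹ * ρ, by group, ?_, ?_⟩
  · simp only [permsSupportedIn, Finset.mem_filter, Finset.mem_univ, true_and]
    intro j hj
    by_cases hji : j < i
    · rw [hα1 j hji]
      exact hfix j (by have : j.val < i.val := hji; omega)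
    · exact hα2 j hji
  · intro j hj
    rw [Equiv.Perm.mul_apply, Equiv.Perm.inv_eq_iff_eq]
    rcases hj.lt_or_eq with h | rfl
    · rw [hα1 j h]
    · rw [hα2 _ (lt_irrefl _), hρi]
  · intro j hj
    rw [Equiv.Perm.mul_apply, Equiv.Perm.inv_eq_iff_eq, hα2]
    intro h
    exact absurd ((hi.1 j).1 h) (not_lt.2 hj.le)

/-- Both permutations preserve `{j | j ≤ i}` and they agree beyond it, so no condition at a later
position distinguishes them. -/
lemma cutsFrom_succ_eq {n : ℕ} {ρ β : Equiv.Perm (Fin n)} {i : Fin n} (hi : IsCut ρ i)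
    (h1 : ∀ j, j ≤ i → β j = j) (h2 : ∀ j, i < j → β j = ρ j) :
    cutsFrom β (i + 1) = cutsFrom ρ (i + 1) := by
  ext l
  simp only [cutsFrom, Finset.mem_filter, Finset.mem_univ, true_and]
  refine and_congr_right fun hl => ?_
  have hil : i < l := hl
  have key : ∀ j, (β j < l ↔ ρ j < l) ∧ (β j ≤ l ↔ ρ j ≤ l) := by
    intro j
    rcases le_or_gt j i with h | h
    · have h3 : ρ j ≤ i := (hi.2 j).2 h
      rw [h1 j h]
      exact ⟨iff_of_true (h.trans_lt hil) (h3.trans_lt hil),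
        iff_of_true (h.trans hil.le) (h3.trans hil.le)⟩
    · rw [h2 j h]; exact ⟨Iff.rfl, Iff.rfl⟩
  simp only [IsCut, (key _).1, (key _).2]

/-- Split `ρ` at its first cut `a + g`. Here `m` is the number of non-cuts from `a` on, whence `g ≤
m`. The left factor may be any permutation of its `g` positions, even one with cuts; this overcount
is harmless. -/
lemma permsWithCuts_succ_subset {n a k m : ℕ} (hn : a + (k + 1) + m = n) :
    permsWithCuts n a (k + 1) ⊆ (Finset.range (m + 1)).biUnion fun g =>
      Finset.image₂ (· * ·) (permsSupportedIn n a (a + g)) (permsWithCuts n (a + g + 1) k) := by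
  intro ρ hρ
  simp only [permsWithCuts, Finset.mem_filter, Finset.mem_univ, true_and] at hρ
  obtain ⟨hfix, hcard⟩ := hρ
  have hne : (cutsFrom ρ a).Nonempty := Finset.card_pos.1 (by omega)
  set i := (cutsFrom ρ a).min' hne with hidef
  have hmem : i ∈ cutsFrom ρ a := Finset.min'_mem _ _
  have hi : a ≤ i.val ∧ IsCut ρ i := by simpa [cutsFrom] using hmem
  have herase : cutsFrom ρ (i + 1) = (cutsFrom ρ a).erase i := by
    ext l
    simp only [cutsFrom, Finset.mem_erase, Finset.mem_filter, Finset.mem_univ, true_and]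
    constructor
    · rintro ⟨h1, h2⟩
      exact ⟨fun h => by subst h; omega, by omega, h2⟩
    · rintro ⟨h1, h2, h3⟩
      have : i ≤ l := Finset.min'_le _ _ (by simp [cutsFrom, h2, h3])
      have h4 : i < l := lt_of_le_of_ne this (Ne.symm h1)
      exact ⟨h4, h3⟩
  have hk : (cutsFrom ρ (i + 1)).card = k := by
    rw [herase, Finset.card_erase_of_mem hmem, hcard]; rfl
  have hkle : k ≤ n - (i.val + 1) := by
    rw [← hk]
    refine le_trans (Finset.card_le_card ?_) (card_filter_between_le n (i.val + 1) n)
    intro l hl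
    simp only [cutsFrom, Finset.mem_filter, Finset.mem_univ, true_and] at hl ⊢
    exact ⟨hl.1, l.isLt⟩
  have hilt := i.isLt
  obtain ⟨α, hα, β, hαβ, hβ1, hβ2⟩ := hi.2.exists_factor hfix
  have hai : a + (i.val - a) = i.val := by omega
  rw [Finset.mem_biUnion]
  refine ⟨i.val - a, Finset.mem_range.2 (by omega), ?_⟩
  rw [Finset.mem_image₂, hai]
  refine ⟨α, hα, β, ?_, hαβ.symm⟩
  simp only [permsWithCuts, Finset.mem_filter, Finset.mem_univ, true_and]
  refine ⟨fun j hj => hβ1 j (Nat.lt_succ_iff.1 hj), ?_⟩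
  rw [cutsFrom_succ_eq hi.2 hβ1 hβ2, hk]

lemma card_permsWithCuts_succ_le {n a k m : ℕ} (hn : a + (k + 1) + m = n) :
    (permsWithCuts n a (k + 1)).card ≤
      ∑ g ∈ Finset.range (m + 1), g.factorial * (permsWithCuts n (a + g + 1) k).card := by
  refine (Finset.card_le_card (permsWithCuts_succ_subset hn)).trans
    (Finset.card_biUnion_le.trans (Finset.sum_le_sum fun g _ => ?_))
  refine (Finset.card_image₂_le _ _ _).trans (Nat.mul_le_mul_right _ ?_)
  simpa using card_permsSupportedIn_le n a (a + g)

/-- A generating-function bound for the number of permutations with a given number of cuts. -/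
lemma card_permsWithCuts_le {x : ℝ} (hx : 0 < x) (M n : ℕ) (k : ℕ) :
    ∀ a m : ℕ, a + k + m = n → m ≤ M → ((permsWithCuts n a k).card : ℝ) ≤
      (x⁻¹) ^ m * (∑ g ∈ Finset.range (M + 1), (g.factorial : ℝ) * x ^ g) ^ (k + 1) := by
  -- By the recursion the count is at most the coefficient of `x ^ m` in `F ^ (k + 1)`. Truncating
  -- at `M` instead of `m` keeps `F` fixed while the induction lowers `m` to `m - g`.
  set F := ∑ g ∈ Finset.range (M + 1), (g.factorial : ℝ) * x ^ g with hF
  have hFnn : 0 ≤ F := Finset.sum_nonneg fun g _ => by positivity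
  induction k with
  | zero =>
    intro a m hn hm
    have h1 : ((permsWithCuts n a 0).card : ℝ) ≤ (m.factorial : ℝ) := by
      have := (Finset.card_le_card (permsWithCuts_zero_subset n a)).trans
        (card_permsSupportedIn_le n a n)
      rw [show n - a = m by omega] at this
      exact_mod_cast this
    have h2 : (m.factorial : ℝ) * x ^ m ≤ F :=
      Finset.single_le_sum (f := fun g : ℕ => (g.factorial : ℝ) * x ^ g)
        (fun g _ => by positivity) (Finset.mem_range.2 (by omega))
    calc ((permsWithCuts n a 0).card : ℝ) ≤ (m.factorial : ℝ) := h1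
      _ = (x⁻¹) ^ m * ((m.factorial : ℝ) * x ^ m) := by
        rw [inv_pow]; field_simp
      _ ≤ (x⁻¹) ^ m * F ^ (0 + 1) := by
        rw [zero_add, pow_one]; gcongr
  | succ k ih =>
    intro a m hn hm
    have h1 : ((permsWithCuts n a (k + 1)).card : ℝ) ≤
        ∑ g ∈ Finset.range (m + 1), (g.factorial : ℝ) * (permsWithCuts n (a + g + 1) k).card := by
      exact_mod_cast card_permsWithCuts_succ_le hn
    calc ((permsWithCuts n a (k + 1)).card : ℝ)
        ≤ ∑ g ∈ Finset.range (m + 1),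
            (g.factorial : ℝ) * (permsWithCuts n (a + g + 1) k).card := h1
      _ ≤ ∑ g ∈ Finset.range (m + 1), (x⁻¹) ^ m * F ^ (k + 1) * ((g.factorial : ℝ) * x ^ g) := by
        refine Finset.sum_le_sum fun g hg => ?_
        have hg' : g ≤ m := Nat.lt_succ_iff.1 (Finset.mem_range.1 hg)
        have h2 := ih (a + g + 1) (m - g) (by omega) (by omega)
        have h3 : (x⁻¹) ^ (m - g) = (x⁻¹) ^ m * x ^ g := by
          rw [inv_pow, inv_pow, ← Nat.sub_add_cancel hg', pow_add, Nat.add_sub_cancel]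
          field_simp
        calc (g.factorial : ℝ) * (permsWithCuts n (a + g + 1) k).card
            ≤ (g.factorial : ℝ) * ((x⁻¹) ^ (m - g) * F ^ (k + 1)) := by gcongr
          _ = _ := by rw [h3]; ring
      _ = (x⁻¹) ^ m * F ^ (k + 1) * ∑ g ∈ Finset.range (m + 1), (g.factorial : ℝ) * x ^ g := by
        rw [Finset.mul_sum]
      _ ≤ (x⁻¹) ^ m * F ^ (k + 1) * F := by
        gcongr
        exact Finset.sum_le_sum_of_subset_of_nonneg
          (Finset.range_mono (by omega)) (fun g _ _ => by positivity)
      _ = (x⁻¹) ^ m * F ^ (k + 1 + 1) := by ring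

/-! ### Choice of the argument of the generating function. -/

/-- The ratio of consecutive terms `g! x ^ g` is `(g + 1) x`, which increases with `g`; the terms
first fall and then rise, so the two ends of the range dominate. -/
lemma factorial_mul_pow_le {x : ℝ} (hx : 0 < x) {g m : ℕ} (hg : 2 ≤ g) (hgm : g ≤ m) :
    (g.factorial : ℝ) * x ^ g ≤ 2 * x ^ 2 + m.factorial * x ^ m := by
  have hstep : ∀ j : ℕ, ((j + 1).factorial : ℝ) * x ^ (j + 1)
      = ((j + 1 : ℕ) * x) * (j.factorial * x ^ j) := by
    intro j; rw [Nat.factorial_succ]; push_cast; ring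
  rcases le_or_gt ((g : ℝ) * x) 1 with h | h
  · have : ∀ j, 2 ≤ j → j ≤ g → (j.factorial : ℝ) * x ^ j ≤ 2 * x ^ 2 := by
      intro j hj
      induction j, hj using Nat.le_induction with
      | base => intro _; simp
      | succ j hj ih =>
        intro hjg
        rw [hstep]
        have h1 : ((j + 1 : ℕ) : ℝ) * x ≤ 1 :=
          le_trans (by gcongr) h
        exact le_trans (mul_le_of_le_one_left (by positivity) h1) (ih (by omega))
    have := this g hg le_rfl
    have h2 : 0 ≤ (m.factorial : ℝ) * x ^ m := by positivity
    linarith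
  · have : (g.factorial : ℝ) * x ^ g ≤ m.factorial * x ^ m := by
      induction m, hgm using Nat.le_induction with
      | base => exact le_rfl
      | succ m hm ih =>
        rw [hstep]
        have h1 : 1 ≤ ((m + 1 : ℕ) : ℝ) * x := by
          refine h.le.trans ?_
          gcongr
          omega
        exact le_trans ih (le_mul_of_one_le_left (by positivity) h1)
    have h2 : 0 ≤ 2 * x ^ 2 := by positivity
    linarith

lemma sum_factorial_mul_pow_le {x : ℝ} (hx : 0 < x) {m : ℕ} (hm : 1 ≤ m) :
    ∑ g ∈ Finset.range (m + 1), (g.factorial : ℝ) * x ^ g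
      ≤ 1 + x + m * (2 * x ^ 2 + m.factorial * x ^ m) := by
  obtain ⟨l, rfl⟩ : ∃ l, m = l + 1 := ⟨m - 1, by omega⟩
  rw [Finset.sum_range_succ', Finset.sum_range_succ']
  have h1 : ∑ g ∈ Finset.range l, ((g + 1 + 1).factorial : ℝ) * x ^ (g + 1 + 1)
      ≤ ∑ g ∈ Finset.range l, (2 * x ^ 2 + (l + 1).factorial * x ^ (l + 1)) :=
    Finset.sum_le_sum fun g hg => factorial_mul_pow_le hx (by omega)
      (by have := Finset.mem_range.1 hg; omega)
  rw [Finset.sum_const, Finset.card_range, nsmul_eq_mul] at h1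
  have h2 : 0 ≤ 2 * x ^ 2 + (l + 1).factorial * x ^ (l + 1) := by positivity
  push_cast
  simp only [Nat.factorial_zero, Nat.factorial_one, Nat.cast_one, pow_zero, pow_one,
    one_mul, mul_one]
  linarith

lemma pow_div_factorial_le_exp (m : ℕ) : (m : ℝ) ^ m / m.factorial ≤ Real.exp m :=
  Real.pow_div_factorial_le_exp (m : ℝ) (Nat.cast_nonneg m) m

/-- To make `x⁻¹ ^ m` comparable to `m!`, `x` is taken near `e / m`; then all terms of the sum but
the constant one are negligible. The factor `(m + 1) ^ 2` makes the last term `m! x ^ m` at most `1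
/ m ^ 2`, so that `m` copies of it are still small. The constant `C` absorbs the finitely many small
`m`. -/
lemma exists_saddle_point {δ : ℝ} (hδ : 0 < δ) : ∃ C : ℝ, 0 < C ∧ ∀ m : ℕ, ∃ x : ℝ, 0 < x ∧
    ∑ g ∈ Finset.range (m + 1), (g.factorial : ℝ) * x ^ g ≤ 1 + δ ∧
    (x⁻¹) ^ m ≤ C * ((m + 1 : ℝ) ^ 2 * m.factorial) := by
  -- The error for large `m` is `3 / m + m * (18 / m ^ 2 + 1 / m ^ 2) = 22 / m`.
  obtain ⟨m₀, hm₀⟩ := exists_nat_ge (22 / δ)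
  have hm₀' : 0 < (m₀ : ℝ) := lt_of_lt_of_le (by positivity) hm₀
  set S := ∑ g ∈ Finset.range (m₀ + 1), (g.factorial : ℝ) with hS
  have hSpos : 0 < S := Finset.sum_pos (fun g _ => by positivity) ⟨0, by simp⟩
  set x₀ := min 1 (δ / S) with hx₀
  have hx₀pos : 0 < x₀ := lt_min one_pos (by positivity)
  have hx₀1 : x₀ ≤ 1 := min_le_left _ _
  have hinv : 1 ≤ x₀⁻¹ := (one_le_inv₀ hx₀pos).2 hx₀1
  refine ⟨(x₀⁻¹) ^ m₀, by positivity, fun m => ?_⟩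
  have hC : 1 ≤ (x₀⁻¹) ^ m₀ := one_le_pow₀ hinv
  have hfac : (1 : ℝ) ≤ m.factorial := by exact_mod_cast Nat.one_le_iff_ne_zero.2 m.factorial_ne_zero
  have hm1 : (1 : ℝ) ≤ (m + 1 : ℝ) ^ 2 := one_le_pow₀ (by linarith [(Nat.cast_nonneg m : (0 : ℝ) ≤ m)])
  rcases lt_or_ge m m₀ with hlt | hge
  · refine ⟨x₀, hx₀pos, ?_, ?_⟩
    · rw [Finset.sum_range_succ']
      have h1 : ∑ g ∈ Finset.range m, ((g + 1).factorial : ℝ) * x₀ ^ (g + 1)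
          ≤ ∑ g ∈ Finset.range m, ((g + 1).factorial : ℝ) * x₀ := by
        refine Finset.sum_le_sum fun g _ => ?_
        gcongr
        exact pow_le_of_le_one hx₀pos.le hx₀1 (by omega)
      have h2 : ∑ g ∈ Finset.range m, ((g + 1).factorial : ℝ) ≤ S := by
        have : ∑ g ∈ Finset.range (m + 1), (g.factorial : ℝ) ≤ S :=
          Finset.sum_le_sum_of_subset_of_nonneg (Finset.range_mono (by omega))
            fun g _ _ => by positivity
        rw [Finset.sum_range_succ'] at this
        have h0 : (0 : ℝ) ≤ (Nat.factorial 0 : ℝ) := by positivity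
        linarith
      rw [← Finset.sum_mul] at h1
      have h3 : S * x₀ ≤ δ := by
        calc S * x₀ ≤ S * (δ / S) := by gcongr; exact min_le_right _ _
          _ = δ := by field_simp
      have h4 : (∑ g ∈ Finset.range m, ((g + 1).factorial : ℝ)) * x₀ ≤ S * x₀ := by gcongr
      simp only [Nat.factorial_zero, Nat.cast_one, pow_zero, one_mul]
      linarith
    · calc (x₀⁻¹) ^ m ≤ (x₀⁻¹) ^ m₀ := pow_le_pow_right₀ hinv hlt.le
        _ = (x₀⁻¹) ^ m₀ * 1 := (mul_one _).symm
        _ ≤ _ := by gcongr; nlinarith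
  · have hmpos : 0 < (m : ℝ) := hm₀'.trans_le (by exact_mod_cast hge)
    have hmne : m ≠ 0 := by rintro rfl; simp at hmpos
    set A := (m + 1 : ℝ) ^ 2 * m.factorial with hA
    have hApos : 0 < A := by positivity
    set x := (A⁻¹) ^ ((m : ℝ)⁻¹) with hx
    have hxpos : 0 < x := Real.rpow_pos_of_pos (by positivity) _
    have hxm : x ^ m = A⁻¹ := Real.rpow_inv_natCast_pow (by positivity) hmne
    -- This is `m! ≥ (m / e) ^ m` with `e < 3`.
    have hxe : x ≤ 3 / m := by
      refine le_of_pow_le_pow_left₀ hmne (by positivity) ?_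
      rw [hxm, div_pow]
      have h1 := pow_div_factorial_le_exp m
      have h2 : Real.exp m ≤ 3 ^ m := by
        rw [← Real.exp_one_pow]
        exact pow_le_pow_left₀ (Real.exp_pos _).le (by linarith [Real.exp_one_lt_d9]) m
      rw [div_le_iff₀ (by positivity)] at h1
      rw [inv_eq_one_div, div_le_div_iff₀ hApos (by positivity), one_mul]
      calc (m : ℝ) ^ m ≤ Real.exp m * m.factorial := h1
        _ ≤ 3 ^ m * A := by
          rw [hA]
          gcongr
          nlinarith
    refine ⟨x, hxpos, ?_, ?_⟩
    · refine (sum_factorial_mul_pow_le hxpos (Nat.one_le_iff_ne_zero.2 hmne)).trans ?_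
      have h1 : (m.factorial : ℝ) * x ^ m ≤ 1 / (m : ℝ) ^ 2 := by
        rw [hxm, hA, mul_inv, mul_comm ((m + 1 : ℝ) ^ 2)⁻¹, ← mul_assoc, mul_inv_cancel₀ (by positivity),
          one_mul, inv_eq_one_div]
        gcongr
        linarith
      have h2 : x ^ 2 ≤ 9 / (m : ℝ) ^ 2 := by
        calc x ^ 2 ≤ (3 / m) ^ 2 := by gcongr
          _ = 9 / (m : ℝ) ^ 2 := by rw [div_pow]; norm_num
      have h3 : 22 / (m : ℝ) ≤ δ := by
        rw [div_le_iff₀ hmpos]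
        rw [div_le_iff₀ hδ] at hm₀
        have : (m₀ : ℝ) ≤ m := by exact_mod_cast hge
        nlinarith
      calc 1 + x + (m : ℝ) * (2 * x ^ 2 + m.factorial * x ^ m)
          ≤ 1 + 3 / (m : ℝ) + m * (2 * (9 / (m : ℝ) ^ 2) + 1 / (m : ℝ) ^ 2) := by gcongr
        _ = 1 + 22 / (m : ℝ) := by field_simp; ring
        _ ≤ 1 + δ := by linarith
    · rw [inv_pow, hxm, inv_inv]
      exact le_mul_of_one_le_left hApos.le hC

lemma exists_card_permsWithCuts_le {δ : ℝ} (hδ : 0 < δ) : ∃ C : ℝ, 0 < C ∧ ∀ k m : ℕ,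
    ((permsWithCuts (k + m) 0 k).card : ℝ) ≤
      C * ((m + 1 : ℝ) ^ 2 * m.factorial) * (1 + δ) ^ (k + 1) := by
  obtain ⟨C, hC, h⟩ := exists_saddle_point hδ
  refine ⟨C, hC, fun k m => ?_⟩
  obtain ⟨x, hx, h1, h2⟩ := h m
  refine (card_permsWithCuts_le hx m (k + m) k 0 m (by omega) le_rfl).trans ?_
  have : 0 ≤ ∑ g ∈ Finset.range (m + 1), (g.factorial : ℝ) * x ^ g :=
    Finset.sum_nonneg fun g _ => by positivity
  gcongr

/-! ### Factorial estimates. -/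

/-- A form of Stirling's upper bound. -/
lemma factorial_mul_exp_le (N : ℕ) :
    ((N + 1).factorial : ℝ) * Real.exp (N + 1) ≤ Real.exp 1 * (N + 1 : ℝ) ^ (N + 2) := by
  induction N with
  | zero => simp
  | succ N ih =>
    -- Equivalent to `(1 - 1 / (N + 2)) ^ (N + 2) ≤ exp (-1)`.
    have key : Real.exp 1 * (N + 1 : ℝ) ^ (N + 2) ≤ (N + 2 : ℝ) ^ (N + 2) := by
      have h1 : ((N + 1 : ℝ) / (N + 2)) ≤ Real.exp (-(1 / (N + 2 : ℝ))) := by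
        have := Real.one_sub_le_exp_neg (1 / (N + 2 : ℝ))
        refine le_trans (le_of_eq ?_) this
        field_simp; ring
      have h2 : ((N + 1 : ℝ) / (N + 2)) ^ (N + 2) ≤ Real.exp (-1) := by
        refine (pow_le_pow_left₀ (by positivity) h1 _).trans (le_of_eq ?_)
        rw [← Real.exp_nat_mul]
        congr 1
        push_cast
        field_simp
      rw [div_pow, div_le_iff₀ (by positivity), Real.exp_neg] at h2
      calc Real.exp 1 * (N + 1 : ℝ) ^ (N + 2)
          ≤ Real.exp 1 * ((Real.exp 1)⁻¹ * (N + 2 : ℝ) ^ (N + 2)) := by gcongr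
        _ = _ := by rw [← mul_assoc, mul_inv_cancel₀ (Real.exp_pos _).ne', one_mul]
    have hexp : Real.exp ((N : ℝ) + 1 + 1) = Real.exp (N + 1) * Real.exp 1 := Real.exp_add _ _
    rw [Nat.factorial_succ]
    push_cast
    rw [hexp]
    calc ((N : ℝ) + 1 + 1) * ((N + 1).factorial : ℝ) * (Real.exp (N + 1) * Real.exp 1)
        = ((N : ℝ) + 2) * Real.exp 1 * (((N + 1).factorial : ℝ) * Real.exp (N + 1)) := by ring
      _ ≤ ((N : ℝ) + 2) * Real.exp 1 * (Real.exp 1 * (N + 1 : ℝ) ^ (N + 2)) := by gcongr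
      _ ≤ ((N : ℝ) + 2) * Real.exp 1 * ((N + 2 : ℝ) ^ (N + 2)) := by gcongr
      _ = Real.exp 1 * ((N : ℝ) + 1 + 1) ^ (N + 1 + 2) := by
        rw [show (N : ℝ) + 1 + 1 = N + 2 by ring]; ring

/-- `n! (e / n) ^ n` is at most `e n`. -/
lemma factorial_mul_exp_div_pow_le {n : ℕ} (hn : 1 ≤ n) :
    (n.factorial : ℝ) * (Real.exp 1 / n) ^ n ≤ Real.exp 1 * n := by
  obtain ⟨N, rfl⟩ : ∃ N, n = N + 1 := ⟨n - 1, by omega⟩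
  have h := factorial_mul_exp_le N
  rw [div_pow, Real.exp_one_pow]
  push_cast
  rw [← mul_div_assoc, div_le_iff₀ (by positivity)]
  calc _ ≤ _ := h
    _ = _ := by ring

/-- The count of pairs that appears in the second moment. -/
lemma factorial_mul_factorial_le {n m : ℕ} (hn : 1 ≤ n) (hm : m ≤ n) :
    (n.factorial : ℝ) * m.factorial * 4 ^ m * (Real.exp 1 / (n + m : ℕ)) ^ (n + m)
      ≤ Real.exp 1 * (n + m : ℕ) * (2 * m + 1) := by
  have h1 := factorial_mul_exp_div_pow_le (n := n + m) (by omega)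
  -- The factor `4 ^ m` is absorbed by a binomial coefficient, which turns `n! m!` into `(n + m)!`.
  have h2 : (4 : ℝ) ^ m ≤ (2 * m + 1) * (n + m).choose m := by
    have h3 := Nat.four_pow_le_two_mul_add_one_mul_central_binom m
    have h4 : (2 * m).choose m ≤ (n + m).choose m := Nat.choose_le_choose m (by omega)
    have h5 : 4 ^ m ≤ (2 * m + 1) * (n + m).choose m := h3.trans (Nat.mul_le_mul_left _ h4)
    exact_mod_cast h5
  have h6 : (((n + m).choose m : ℕ) : ℝ) * n.factorial * m.factorial = (n + m).factorial := by
    exact_mod_cast Nat.add_choose_mul_factorial_mul_factorial n m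
  set E := (Real.exp 1 / (n + m : ℕ)) ^ (n + m) with hE
  have hEpos : 0 ≤ E := by positivity
  calc (n.factorial : ℝ) * m.factorial * 4 ^ m * E
      ≤ (n.factorial : ℝ) * m.factorial * ((2 * m + 1) * (n + m).choose m) * E := by gcongr
    _ = (2 * m + 1) * (((n + m).choose m * n.factorial * m.factorial) * E) := by ring
    _ ≤ (2 * m + 1) * (Real.exp 1 * (n + m : ℕ)) := by rw [h6]; gcongr
    _ = _ := by ring

/-! ### Sums of independent exponential variables. -/

instance isProbabilityMeasure_expMeasure_one : IsProbabilityMeasure (expMeasure 1) :=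
  isProbabilityMeasure_expMeasure one_pos

lemma expMeasure_one_eq : expMeasure 1 =
    (volume.restrict (Set.Ioi (0 : ℝ))).withDensity fun x => ENNReal.ofReal (Real.exp (-x)) := by
  have h1 : expMeasure 1 = volume.withDensity (exponentialPDF 1) := rfl
  rw [h1, ← withDensity_indicator measurableSet_Ioi]
  refine withDensity_congr_ae ?_
  filter_upwards [Measure.ae_ne volume (0 : ℝ)] with x hx
  rw [exponentialPDF_eq, Set.indicator_apply]
  rcases lt_or_gt_of_ne hx with h | h
  · rw [if_neg (not_le.2 h), if_neg (by simpa using h.le), ENNReal.ofReal_zero]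
  · rw [if_pos h.le, if_pos (by simpa using h)]; simp

lemma lintegral_expMeasure_one (f : ℝ → ℝ≥0∞) (hf : Measurable f) :
    ∫⁻ x, f x ∂(expMeasure 1) = ∫⁻ x in Set.Ioi 0, ENNReal.ofReal (Real.exp (-x)) * f x := by
  rw [expMeasure_one_eq, lintegral_withDensity_eq_lintegral_mul _ (by fun_prop) hf]
  rfl

lemma integral_exp_neg_mul_expMeasure_one {a : ℝ} (ha : 0 ≤ a) :
    ∫ x, Real.exp (-(a * x)) ∂(expMeasure 1) = (1 + a)⁻¹ := by
  rw [expMeasure_one_eq, integral_withDensity_eq_integral_toReal_smul (by fun_prop) (by simp)]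
  have h1 : ∀ x : ℝ, (ENNReal.ofReal (Real.exp (-x))).toReal • Real.exp (-(a * x))
      = Real.exp (-(1 + a) * x) := fun x => by
    rw [ENNReal.toReal_ofReal (Real.exp_pos _).le, smul_eq_mul, ← Real.exp_add]
    congr 1; ring
  simp_rw [h1]
  rw [integral_exp_mul_Ioi (by linarith)]
  rw [mul_zero, Real.exp_zero, neg_div_neg_eq, one_div]

lemma integrable_exp_neg_mul_expMeasure_one {a : ℝ} (ha : 0 ≤ a) :
    Integrable (fun x => Real.exp (-(a * x))) (expMeasure 1) := by
  -- A non-integrable function has Bochner integral `0`, whereas the integral just computed is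
  -- positive.
  by_contra h
  have := integral_undef h
  rw [integral_exp_neg_mul_expMeasure_one ha] at this
  have h2 : 0 < (1 + a)⁻¹ := by positivity
  linarith

/-- The joint law of independent exponential variables of mean one. -/
noncomputable def expPi (ι : Type*) [Fintype ι] : Measure (ι → ℝ) :=
  Measure.pi fun _ => expMeasure 1

instance (ι : Type*) [Fintype ι] : IsProbabilityMeasure (expPi ι) := by
  unfold expPi; infer_instance

/-- Chernoff's bound for nonnegative combinations of exponential variables. -/
lemma expPi_real_sum_mul_le {ι : Type*} [Fintype ι] (c : ι → ℝ) (hc : ∀ e, 0 ≤ c e) (u : ℝ) :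
    (expPi ι).real {w | ∑ e, c e * w e ≤ u} ≤ Real.exp u * ∏ e, (1 + c e)⁻¹ := by
  have hprod : ∀ w : ι → ℝ, Real.exp ((-1) * ∑ e, c e * w e)
      = ∏ e, Real.exp (-(c e * w e)) := fun w => by
    rw [← Real.exp_sum]; congr 1; rw [neg_one_mul, ← Finset.sum_neg_distrib]
  have hint : Integrable (fun w : ι → ℝ => Real.exp ((-1) * ∑ e, c e * w e)) (expPi ι) := by
    simp_rw [hprod]
    exact Integrable.fintype_prod (f := fun e x => Real.exp (-(c e * x)))
      fun e => integrable_exp_neg_mul_expMeasure_one (hc e)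
  have h := measure_le_le_exp_mul_mgf (μ := expPi ι) (X := fun w => ∑ e, c e * w e) (t := -1) u
    (by norm_num) hint
  refine h.trans (le_of_eq ?_)
  rw [mgf, neg_neg, one_mul]
  simp_rw [hprod]
  unfold expPi
  rw [integral_fintype_prod_eq_prod (f := fun e x => Real.exp (-(c e * x)))]
  simp_rw [integral_exp_neg_mul_expMeasure_one (hc _)]

/-- Chernoff's bound for `θ` times the sum of both weights: a shared variable has coefficient `2 *
θ`, any other one `θ`. -/
lemma expPi_real_two_sums_le {ι : Type*} [Fintype ι] [DecidableEq ι] (A B : Finset ι) {θ : ℝ}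
    (hθ : 0 ≤ θ) (t : ℝ) :
    (expPi ι).real {w | ∑ e ∈ A, w e ≤ t ∧ ∑ e ∈ B, w e ≤ t} ≤
      Real.exp (2 * θ * t) * (((1 + 2 * θ)⁻¹) ^ (A ∩ B).card *
        ((1 + θ)⁻¹) ^ ((A \ B).card + (B \ A).card)) := by
  set c : ι → ℝ := fun e => (if e ∈ A then θ else 0) + if e ∈ B then θ else 0 with hcdef
  have hc : ∀ e, 0 ≤ c e := fun e => by
    simp only [hcdef]; split_ifs <;> linarith
  have hsub : {w : ι → ℝ | ∑ e ∈ A, w e ≤ t ∧ ∑ e ∈ B, w e ≤ t} ⊆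
      {w | ∑ e, c e * w e ≤ 2 * θ * t} := by
    rintro w ⟨h1, h2⟩
    have : ∑ e, c e * w e = θ * ∑ e ∈ A, w e + θ * ∑ e ∈ B, w e := by
      simp only [hcdef, add_mul, Finset.sum_add_distrib, ite_mul, zero_mul, Finset.mul_sum,
        Finset.sum_ite_mem, Finset.univ_inter]
    rw [Set.mem_ofPred_eq, this]
    nlinarith
  refine (measureReal_mono hsub).trans ((expPi_real_sum_mul_le c hc _).trans (le_of_eq ?_))
  congr 1
  have hfac : ∀ e, (1 + c e)⁻¹ = (if e ∈ A ∩ B then (1 + 2 * θ)⁻¹ else 1) *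
      ((if e ∈ A \ B then (1 + θ)⁻¹ else 1) * if e ∈ B \ A then (1 + θ)⁻¹ else 1) := fun e => by
    simp only [hcdef, Finset.mem_inter, Finset.mem_sdiff]
    by_cases h1 : e ∈ A <;> by_cases h2 : e ∈ B <;> simp [h1, h2, two_mul]
  simp_rw [hfac, Finset.prod_mul_distrib, Finset.prod_ite_mem, Finset.univ_inter,
    Finset.prod_const]
  rw [pow_add]

lemma measurePreserving_expPi_comp {ι κ : Type*} [Fintype ι] [Fintype κ] {g : ι → κ}
    (hg : g.Injective) : MeasurePreserving (fun (w : κ → ℝ) i => w (g i)) (expPi κ) (expPi ι) := by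
  have h1 : iIndepFun (fun (e : κ) (w : κ → ℝ) => w e) (expPi κ) :=
    iIndepFun_pi (X := fun _ x => x) fun _ => aemeasurable_id
  have h2 := h1.precomp hg
  have h3 : ∀ i : ι, HasLaw (fun w : κ → ℝ => w (g i)) (expMeasure 1) (expPi κ) := fun i =>
    (measurePreserving_eval (fun _ : κ => expMeasure 1) (g i)).hasLaw
  exact (h2.hasLaw_pi h3).measurePreserving (by fun_prop)

/-- Independence of blocks of coordinates. -/
lemma expPi_blocks {ι κ : Type*} [Fintype ι] [Fintype κ] {S : Set (κ → ℝ)}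
    (hS : MeasurableSet S) :
    expPi (ι × κ) {w | ∀ i, (fun k => w (i, k)) ∈ S} = (expPi κ S) ^ Fintype.card ι := by
  have h1 : iIndepFun (fun (p : ι × κ) (w : ι → κ → ℝ) => w p.1 p.2)
      (Measure.pi fun _ : ι => expPi κ) := by
    have := iIndepFun_uncurry_infinitePi' (Ω := fun (_ : ι) (_ : κ) => ℝ) (X := fun _ _ x => x)
      (fun _ _ => expMeasure 1) (fun _ _ => measurable_id)
    simpa only [Measure.infinitePi_eq_pi, expPi] using this
  have h2 : ∀ p : ι × κ, HasLaw (fun w : ι → κ → ℝ => w p.1 p.2) (expMeasure 1)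
      (Measure.pi fun _ : ι => expPi κ) := fun p =>
    (((measurePreserving_eval (fun _ : κ => expMeasure 1) p.2).comp
      (measurePreserving_eval (fun _ : ι => expPi κ) p.1))).hasLaw
  have h3 := (h1.hasLaw_pi h2).measurePreserving (by fun_prop)
  have hmeas : MeasurableSet {w : ι × κ → ℝ | ∀ i, (fun k => w (i, k)) ∈ S} := by
    rw [Set.ofPred_forall]
    exact MeasurableSet.iInter fun i =>
      measurableSet_preimage (f := fun (w : ι × κ → ℝ) k => w (i, k)) (by fun_prop) hS
  have h4 := h3.measure_preimage hmeas.nullMeasurableSet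
  rw [expPi, ← h4]
  have h5 : (fun (w : ι → κ → ℝ) (p : ι × κ) => w p.1 p.2) ⁻¹'
      {w : ι × κ → ℝ | ∀ i, (fun k => w (i, k)) ∈ S} = Set.univ.pi fun _ => S := by
    ext w; simp
  rw [h5, Measure.pi_pi, Finset.prod_const, Finset.card_univ]

lemma expMeasure_one_Iic {s : ℝ} (hs : 0 ≤ s) :
    expMeasure 1 (Set.Iic s) = ENNReal.ofReal (1 - Real.exp (-s)) := by
  have h := cdf_expMeasure_eq one_pos s
  rw [cdf_eq_real, if_pos hs, one_mul] at h
  rw [← h, ofReal_measureReal]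

lemma expPi_forall_le {ι : Type*} [Fintype ι] {s : ℝ} (hs : 0 ≤ s) :
    expPi ι {w | ∀ i, w i ≤ s} = ENNReal.ofReal (1 - Real.exp (-s)) ^ Fintype.card ι := by
  have h : {w : ι → ℝ | ∀ i, w i ≤ s} = Set.univ.pi fun _ => Set.Iic s := by
    ext w; simp only [Set.mem_ofPred_eq, Set.mem_univ_pi, Set.mem_Iic]
  rw [h, expPi, Measure.pi_pi, Finset.prod_const, Finset.card_univ, expMeasure_one_Iic hs]

/-- Integrate out the first variable: its density `exp (-x)` and the factor `exp (-(t - x))` from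
the induction hypothesis combine to the constant `exp (-t)`. -/
lemma expPi_sum_le_ge (n : ℕ) : ∀ t : ℝ, 0 ≤ t →
    ENNReal.ofReal (Real.exp (-t) * t ^ n / n.factorial) ≤ expPi (Fin n) {w | ∑ i, w i ≤ t} := by
  induction n with
  | zero =>
    intro t ht
    have : {w : Fin 0 → ℝ | ∑ i, w i ≤ t} = Set.univ := by ext w; simpa using ht
    rw [this, measure_univ]
    simp [ht]
  | succ n ih =>
    intro t ht
    have hmp := measurePreserving_piFinSuccAbove (fun _ : Fin (n + 1) => expMeasure 1) 0
    have hset : {w : Fin (n + 1) → ℝ | ∑ i, w i ≤ t} =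
        (MeasurableEquiv.piFinSuccAbove (fun _ : Fin (n + 1) => ℝ) 0) ⁻¹'
          {p | p.1 + ∑ i, p.2 i ≤ t} := by
      ext w
      simp [MeasurableEquiv.piFinSuccAbove, Fin.sum_univ_succ, Fin.insertNthEquiv, Fin.tail]
    have hms : MeasurableSet {p : ℝ × (Fin n → ℝ) | p.1 + ∑ i, p.2 i ≤ t} :=
      measurableSet_le (by fun_prop) measurable_const
    have hslice : ∀ x : ℝ, (Measure.pi fun _ : Fin n => expMeasure 1)
        (Prod.mk x ⁻¹' {p : ℝ × (Fin n → ℝ) | p.1 + ∑ i, p.2 i ≤ t})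
          = expPi (Fin n) {w | ∑ i, w i ≤ t - x} := fun x => by
      have : Prod.mk x ⁻¹' {p : ℝ × (Fin n → ℝ) | p.1 + ∑ i, p.2 i ≤ t}
          = {w | ∑ i, w i ≤ t - x} := by
        ext w; simp [le_sub_iff_add_le']
      rw [this]; rfl
    have hmeas : Measurable fun x : ℝ => expPi (Fin n) {w | ∑ i, w i ≤ t - x} := by
      simp_rw [← hslice]; exact measurable_measure_prodMk_left hms
    have hint : ∫ x in (0 : ℝ)..t, Real.exp (-t) / n.factorial * (t - x) ^ n
        = Real.exp (-t) * t ^ (n + 1) / (n + 1).factorial := by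
      rw [intervalIntegral.integral_const_mul,
        intervalIntegral.integral_comp_sub_left (fun x => x ^ n) t, integral_pow,
        Nat.factorial_succ]
      push_cast
      have : ((n : ℝ) + 1) ≠ 0 := by positivity
      have : (n.factorial : ℝ) ≠ 0 := by positivity
      field_simp
      simp
    rw [hset, expPi, hmp.measure_preimage hms.nullMeasurableSet, Measure.prod_apply hms]
    change _ ≤ ∫⁻ x, (Measure.pi fun _ : Fin n => expMeasure 1)
        (Prod.mk x ⁻¹' {p : ℝ × (Fin n → ℝ) | p.1 + ∑ i, p.2 i ≤ t}) ∂(expMeasure 1)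
    simp_rw [hslice]
    rw [lintegral_expMeasure_one _ hmeas, ← hint, intervalIntegral.integral_of_le ht,
      ofReal_integral_eq_lintegral_ofReal]
    · calc ∫⁻ x in Set.Ioc 0 t, ENNReal.ofReal (Real.exp (-t) / n.factorial * (t - x) ^ n)
          ≤ ∫⁻ x in Set.Ioc 0 t, ENNReal.ofReal (Real.exp (-x)) *
              expPi (Fin n) {w | ∑ i, w i ≤ t - x} := by
            refine setLIntegral_mono' measurableSet_Ioc fun x hx => ?_
            refine le_trans (le_of_eq ?_) (mul_le_mul_right (ih (t - x) (by linarith [hx.2])) _)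
            rw [← ENNReal.ofReal_mul (Real.exp_pos _).le]
            congr 1
            rw [show -t = -x + -(t - x) by ring, Real.exp_add]
            ring
        _ ≤ _ := lintegral_mono_set Set.Ioc_subset_Ioi_self
    · exact (Continuous.integrableOn_Icc (by fun_prop)).mono_set Set.Ioc_subset_Icc_self
    · filter_upwards [ae_restrict_mem measurableSet_Ioc] with x hx
      have : 0 ≤ t - x := by linarith [hx.2]
      positivity

lemma expPi_real_sum_finset_ge {ι : Type*} [Fintype ι] [DecidableEq ι] (A : Finset ι) {t : ℝ}
    (ht : 0 ≤ t) : Real.exp (-t) * t ^ A.card / A.card.factorial ≤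
      (expPi ι).real {w | ∑ e ∈ A, w e ≤ t} := by
  set g : Fin A.card → ι := fun i => A.equivFin.symm i with hg
  have hinj : g.Injective := Subtype.val_injective.comp A.equivFin.symm.injective
  have hmp := measurePreserving_expPi_comp hinj
  have hms : MeasurableSet {w : Fin A.card → ℝ | ∑ i, w i ≤ t} :=
    measurableSet_le (by fun_prop) measurable_const
  have h1 := hmp.measure_preimage hms.nullMeasurableSet
  have h2 : (fun (w : ι → ℝ) i => w (g i)) ⁻¹' {w : Fin A.card → ℝ | ∑ i, w i ≤ t}
      = {w | ∑ e ∈ A, w e ≤ t} := by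
    ext w
    simp only [Set.mem_preimage, Set.mem_ofPred_eq]
    rw [← Finset.sum_coe_sort A w, ← A.equivFin.symm.sum_comp]
  have h3 := expPi_sum_le_ge A.card t ht
  rw [← h1, h2] at h3
  rw [measureReal_def]
  exact (ENNReal.ofReal_le_iff_le_toReal (measure_ne_top _ _)).1 h3

/-! ### The second-moment inequality. -/

/-- The second-moment method for a finite family of events. -/
lemma sq_sum_measureReal_le {Ω α : Type*} [MeasurableSpace Ω] (μ : Measure Ω)
    [IsProbabilityMeasure μ] (s : Finset α) (A : α → Set Ω) (hA : ∀ a, MeasurableSet (A a)) :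
    (∑ a ∈ s, μ.real (A a)) ^ 2 ≤
      μ.real (⋃ a ∈ s, A a) * ∑ a ∈ s, ∑ b ∈ s, μ.real (A a ∩ A b) := by
  set U := ⋃ a ∈ s, A a with hU
  have hUm : MeasurableSet U := Finset.measurableSet_biUnion _ fun a _ => hA a
  set M := ∑ a ∈ s, μ.real (A a) with hM
  set V := ∑ a ∈ s, ∑ b ∈ s, μ.real (A a ∩ A b) with hV
  have hind : ∀ {B : Set Ω}, MeasurableSet B → Integrable (B.indicator (1 : Ω → ℝ)) μ :=
    fun hB => (integrable_const (1 : ℝ)).indicator hB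
  -- With `Z` the number of events that occur, this is `E (l * 1_U - Z) ^ 2 ≥ 0`, using `Z * 1_U =
  -- Z`. The discriminant of this quadratic in `l` is the claim.
  have key : ∀ l : ℝ, 0 ≤ μ.real U * (l * l) + (-2 * M) * l + V := by
    intro l
    have h1 : ∀ ω, (l * U.indicator (1 : Ω → ℝ) ω - ∑ a ∈ s, (A a).indicator (1 : Ω → ℝ) ω) ^ 2
        = l * l * U.indicator (1 : Ω → ℝ) ω - 2 * l * ∑ a ∈ s, (A a).indicator (1 : Ω → ℝ) ω
          + ∑ a ∈ s, ∑ b ∈ s, (A a ∩ A b).indicator (1 : Ω → ℝ) ω := by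
      intro ω
      have hmul : ∀ a b, (A a ∩ A b).indicator (1 : Ω → ℝ) ω
          = (A a).indicator (1 : Ω → ℝ) ω * (A b).indicator (1 : Ω → ℝ) ω := fun a b => by
        rw [Set.inter_indicator_one]; rfl
      simp_rw [hmul, ← Finset.sum_mul_sum]
      by_cases hω : ω ∈ U
      · rw [Set.indicator_of_mem hω, Pi.one_apply]; ring
      · have h0 : ∑ a ∈ s, (A a).indicator (1 : Ω → ℝ) ω = 0 := by
          refine Finset.sum_eq_zero fun a ha => Set.indicator_of_notMem (fun h => hω ?_) _
          exact Set.mem_biUnion (s := (s : Set α)) ha h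
        rw [h0, Set.indicator_of_notMem hω]; ring
    have h2 : 0 ≤ ∫ ω, (l * U.indicator (1 : Ω → ℝ) ω -
        ∑ a ∈ s, (A a).indicator (1 : Ω → ℝ) ω) ^ 2 ∂μ := integral_nonneg fun ω => sq_nonneg _
    simp_rw [h1] at h2
    have i1 : Integrable (fun ω => l * l * U.indicator (1 : Ω → ℝ) ω) μ := (hind hUm).const_mul _
    have i2 : Integrable (fun ω => 2 * l * ∑ a ∈ s, (A a).indicator (1 : Ω → ℝ) ω) μ :=
      (integrable_finsetSum _ fun a _ => hind (hA a)).const_mul _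
    have i3 : Integrable (fun ω => ∑ a ∈ s, ∑ b ∈ s, (A a ∩ A b).indicator (1 : Ω → ℝ) ω) μ :=
      integrable_finsetSum _ fun a _ => integrable_finsetSum _ fun b _ =>
        hind ((hA a).inter (hA b))
    have i4 : Integrable (fun ω => l * l * U.indicator (1 : Ω → ℝ) ω -
        2 * l * ∑ a ∈ s, (A a).indicator (1 : Ω → ℝ) ω) μ := i1.sub i2
    rw [integral_add i4 i3, integral_sub i1 i2, integral_const_mul, integral_const_mul,
      integral_indicator_one hUm, integral_finsetSum _ fun a _ => hind (hA a),
      integral_finsetSum _ fun a _ => integrable_finsetSum _ fun b _ =>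
        hind ((hA a).inter (hA b))] at h2
    simp_rw [integral_indicator_one (hA _)] at h2
    have h3 : ∀ a, ∫ ω, ∑ b ∈ s, (A a ∩ A b).indicator (1 : Ω → ℝ) ω ∂μ
        = ∑ b ∈ s, μ.real (A a ∩ A b) := fun a => by
      rw [integral_finsetSum _ fun b _ => hind ((hA a).inter (hA b))]
      simp_rw [integral_indicator_one ((hA a).inter (hA _))]
    simp_rw [h3] at h2
    rw [← hM, ← hV] at h2
    linarith
  have hd := discrim_le_zero key
  rw [discrim] at hd
  nlinarith

/-! ### Paths as permutations, shared edges as cuts. -/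

/-- The path that flips the coordinates `σ 0, σ 1, …` in this order. -/
def permPath {n : ℕ} (σ : Equiv.Perm (Fin n)) : OrientedPath n := by
  refine ⟨fun i j => decide ((σ.symm j).val < i.val), ?_, ?_, ?_⟩
  · funext j; simp
  · funext j; simp
  · intro i
    change hammingDist _ _ = 1
    rw [hammingDist, Finset.card_eq_one]
    refine ⟨σ i, ?_⟩
    ext j
    simp only [Finset.mem_filter, Finset.mem_univ, true_and, Finset.mem_singleton, ne_eq,
      decide_eq_decide, Fin.val_castSucc, Fin.val_succ]
    rw [← Equiv.symm_apply_eq, Fin.ext_iff]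
    omega

lemma permPath_apply {n : ℕ} (σ : Equiv.Perm (Fin n)) (i : Fin (n + 1)) (j : Fin n) :
    (permPath σ).1 i j = decide ((σ.symm j).val < i.val) := rfl

/-- Each step flips one coordinate. Every coordinate goes from `false` to `true`, so all of them
occur among the `n` flips, and each exactly once. -/
lemma permPath_surjective (n : ℕ) : Function.Surjective (permPath (n := n)) := by
  rintro ⟨v, h0, h1, hadj⟩
  have hflip : ∀ i : Fin n, ∃ c, ∀ j, v i.castSucc j ≠ v i.succ j ↔ j = c := by
    intro i
    have h : hammingDist (v i.castSucc) (v i.succ) = 1 := hadj i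
    rw [hammingDist, Finset.card_eq_one] at h
    obtain ⟨c, hc⟩ := h
    refine ⟨c, fun j => ?_⟩
    rw [← Finset.mem_singleton, ← hc]; simp
  choose c hc using hflip
  have hsurj : Function.Surjective c := by
    intro j
    by_contra! hne
    have hconst : ∀ i : ℕ, ∀ hi : i < n + 1, v ⟨i, hi⟩ j = false := by
      intro i
      induction i with
      | zero => intro hi; exact congrFun h0 j
      | succ i ih =>
        intro hi
        have h2 := mt (hc ⟨i, by omega⟩ j).1 (hne _).symm
        rw [not_not] at h2
        exact h2.symm.trans (ih (by omega))
    have h3 : v (Fin.last n) j = true := congrFun h1 j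
    rw [show Fin.last n = ⟨n, by omega⟩ from rfl, hconst] at h3
    exact Bool.false_ne_true h3
  have hbij : Function.Bijective c := Finite.injective_iff_bijective.1
    (Finite.injective_iff_surjective.2 hsurj)
  refine ⟨Equiv.ofBijective c hbij, Subtype.ext ?_⟩
  set σ := Equiv.ofBijective c hbij with hσ
  have hσc : ∀ i, σ i = c i := fun _ => rfl
  have key : ∀ i : ℕ, ∀ hi : i < n + 1, ∀ j, v ⟨i, hi⟩ j = decide ((σ.symm j).val < i) := by
    intro i
    induction i with
    | zero => intro hi j; simpa using congrFun h0 j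
    | succ i ih =>
      intro hi j
      have h2 := hc ⟨i, by omega⟩ j
      rw [← hσc, ← Equiv.symm_apply_eq, Fin.ext_iff] at h2
      have h3 := ih (by omega) j
      simp only [Fin.castSucc_mk, Fin.succ_mk] at h2
      rw [h3] at h2
      by_cases hj : (σ.symm j).val = i
      · have h4 := h2.2 hj
        simp only [hj, lt_irrefl, decide_false, ne_eq] at h4
        simp only [hj, Nat.lt_succ_self, decide_true]
        exact Bool.eq_true_of_not_eq_false (Ne.symm h4)
      · have h4 := mt h2.1 hj
        rw [not_not] at h4
        rw [← h4, decide_eq_decide]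
        omega
  funext i j
  rw [permPath_apply]
  exact (key i.val i.isLt j).symm

lemma card_filter_permPath {n : ℕ} (σ : Equiv.Perm (Fin n)) (i : Fin (n + 1)) :
    (Finset.univ.filter fun j => (permPath σ).1 i j = true).card = i.val := by
  simp only [permPath_apply, decide_eq_true_eq]
  have h1 : (Finset.univ.filter fun j : Fin n => (σ.symm j).val < i.val)
      = (Finset.univ.filter fun j : Fin n => j.val < i.val).map σ.toEmbedding := by
    ext j
    simp only [Finset.mem_filter, Finset.mem_univ, true_and, Finset.mem_map_equiv]
  rw [h1, Finset.card_map, Fin.card_filter_val_lt]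
  exact min_eq_right (Nat.lt_succ_iff.1 i.isLt)

lemma permPath_eq_imp {n : ℕ} {σ τ : Equiv.Perm (Fin n)} {i j : Fin (n + 1)}
    (h : (permPath σ).1 i = (permPath τ).1 j) : i = j := by
  have h1 := card_filter_permPath σ i
  rw [h, card_filter_permPath] at h1
  exact Fin.ext h1.symm

lemma permPath_edge_eq {n : ℕ} {σ τ : Equiv.Perm (Fin n)} {i j : Fin n}
    (h : (permPath σ).edge i = (permPath τ).edge j) :
    i = j ∧ (permPath σ).1 i.castSucc = (permPath τ).1 j.castSucc ∧
      (permPath σ).1 i.succ = (permPath τ).1 j.succ := by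
  have h1 := congrArg Subtype.val h
  simp only [OrientedPath.edge] at h1
  rw [Sym2.eq_iff] at h1
  rcases h1 with ⟨h1, h2⟩ | ⟨h1, h2⟩
  · exact ⟨Fin.castSucc_injective _ (permPath_eq_imp h1), h1, h2⟩
  -- An edge traversed in opposite directions would force `i = j + 1` and `i + 1 = j`.
  · have h3 := congrArg Fin.val (permPath_eq_imp h1)
    have h4 := congrArg Fin.val (permPath_eq_imp h2)
    simp only [Fin.val_castSucc, Fin.val_succ] at h3 h4
    omega

/-- The set of edges of the path that flips the coordinates in the order given by `σ`. -/
def permEdges {n : ℕ} (σ : Equiv.Perm (Fin n)) : Finset (graph n).edgeSet :=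
  Finset.univ.image (permPath σ).edge

lemma permPath_edge_injective {n : ℕ} (σ : Equiv.Perm (Fin n)) :
    Function.Injective (permPath σ).edge := fun _ _ h => (permPath_edge_eq h).1

lemma card_permEdges {n : ℕ} (σ : Equiv.Perm (Fin n)) : (permEdges σ).card = n := by
  rw [permEdges, Finset.card_image_of_injective _ (permPath_edge_injective σ), Finset.card_univ,
    Fintype.card_fin]

lemma pathWeight_permPath {n : ℕ} (w : (graph n).edgeSet → ℝ) (σ : Equiv.Perm (Fin n)) :
    pathWeight w (permPath σ) = ∑ e ∈ permEdges σ, w e := by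
  rw [permEdges, Finset.sum_image fun _ _ _ _ h => permPath_edge_injective σ h]
  rfl

/-- A common edge occurs at the same step `j` of both paths, and its endpoints say that `σ` and `τ`
have the same image of `{l | l < j}` and of `{l | l ≤ j}`. -/
lemma card_permEdges_inter_le {n : ℕ} (σ τ : Equiv.Perm (Fin n)) :
    (permEdges σ ∩ permEdges τ).card ≤ (cutsFrom (σ⁻¹ * τ) 0).card := by
  have hsub : permEdges σ ∩ permEdges τ ⊆ (cutsFrom (σ⁻¹ * τ) 0).image (permPath τ).edge := by
    intro e he
    simp only [permEdges, Finset.mem_inter, Finset.mem_image, Finset.mem_univ, true_and] at he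
    obtain ⟨⟨i, rfl⟩, ⟨j, hj⟩⟩ := he
    obtain ⟨rfl, h1, h2⟩ := permPath_edge_eq hj
    refine Finset.mem_image.2 ⟨j, ?_, hj⟩
    simp only [cutsFrom, Finset.mem_filter, Finset.mem_univ, true_and, Nat.zero_le]
    have h3 : ∀ l, (τ.symm l).val < j.val ↔ (σ.symm l).val < j.val := fun l => by
      have := congrFun h1 l
      rwa [permPath_apply, permPath_apply, decide_eq_decide] at this
    have h4 : ∀ l, (τ.symm l).val < j.val + 1 ↔ (σ.symm l).val < j.val + 1 := fun l => by
      have := congrFun h2 l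
      rwa [permPath_apply, permPath_apply, decide_eq_decide] at this
    refine ⟨fun l => ?_, fun l => ?_⟩
    · have := h3 (τ l)
      rw [Equiv.symm_apply_apply] at this
      exact this.symm
    · have := h4 (τ l)
      rw [Equiv.symm_apply_apply] at this
      have h5 : (σ.symm (τ l)).val ≤ j.val ↔ l.val ≤ j.val := by
        simpa only [Nat.lt_succ_iff] using this.symm
      exact h5
  exact (Finset.card_le_card hsub).trans Finset.card_image_le

lemma minWeight_le {n : ℕ} (w : (graph n).edgeSet → ℝ) (p : OrientedPath n) :
    minWeight w ≤ pathWeight w p :=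
  Finset.inf'_le _ (Finset.mem_univ p)

lemma exists_minWeight_eq {n : ℕ} (w : (graph n).edgeSet → ℝ) :
    ∃ p, minWeight w = pathWeight w p := by
  obtain ⟨p, -, hp⟩ := Finset.exists_mem_eq_inf' (Finset.univ_nonempty (α := OrientedPath n))
    fun p => pathWeight w p
  exact ⟨p, hp⟩

lemma minWeight_le_iff {n : ℕ} (w : (graph n).edgeSet → ℝ) (t : ℝ) :
    minWeight w ≤ t ↔ ∃ σ, ∑ e ∈ permEdges σ, w e ≤ t := by
  constructor
  · intro h
    obtain ⟨p, hp⟩ := exists_minWeight_eq w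
    obtain ⟨σ, rfl⟩ := permPath_surjective n p
    exact ⟨σ, by rwa [← pathWeight_permPath, ← hp]⟩
  · rintro ⟨σ, hσ⟩
    exact (minWeight_le w (permPath σ)).trans (by rwa [pathWeight_permPath])

lemma measurable_pathWeight {n : ℕ} (p : OrientedPath n) :
    Measurable fun w : (graph n).edgeSet → ℝ => pathWeight w p := by
  unfold pathWeight; fun_prop

lemma measurable_minWeight (n : ℕ) :
    Measurable (minWeight : ((graph n).edgeSet → ℝ) → ℝ) := by
  have : (minWeight : ((graph n).edgeSet → ℝ) → ℝ) = Finset.univ.inf' Finset.univ_nonempty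
      (fun (p : OrientedPath n) (w : (graph n).edgeSet → ℝ) => pathWeight w p) := by
    funext w; rw [Finset.inf'_apply]; rfl
  rw [this]
  exact Finset.inf'_induction _ _ (fun _ hf _ hg => hf.inf hg) fun p _ => measurable_pathWeight p

lemma setOf_minWeight_le (n : ℕ) (t : ℝ) :
    {w : (graph n).edgeSet → ℝ | minWeight w ≤ t}
      = ⋃ σ ∈ (Finset.univ : Finset (Equiv.Perm (Fin n))), {w | ∑ e ∈ permEdges σ, w e ≤ t} := by
  ext w
  simp [minWeight_le_iff]

/-! ### First and second moment of the number of light paths. -/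

lemma expPi_real_minWeight_le {n : ℕ} (hn : 1 ≤ n) {t : ℝ} (ht : 0 < t) :
    (expPi (graph n).edgeSet).real {w | minWeight w ≤ t} ≤ Real.exp 1 * n * t ^ n := by
  have hn' : (0 : ℝ) < n := by exact_mod_cast hn
  have hone : ∀ σ : Equiv.Perm (Fin n),
      (expPi (graph n).edgeSet).real {w | ∑ e ∈ permEdges σ, w e ≤ t}
        ≤ (Real.exp 1 / n) ^ n * t ^ n := by
    intro σ
    -- With both sets equal this is the one-path bound with parameter `2 * θ = n / t`, its optimal
    -- order.
    have h := expPi_real_two_sums_le (permEdges σ) (permEdges σ) (θ := n / (2 * t))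
      (by positivity) t
    simp only [and_self, Finset.inter_self, Finset.sdiff_self, Finset.card_empty, card_permEdges,
      add_zero, pow_zero, mul_one] at h
    refine h.trans ?_
    have h1 : 2 * ((n : ℝ) / (2 * t)) = n / t := by field_simp
    rw [h1, div_mul_cancel₀ _ ht.ne', div_pow, Real.exp_one_pow, div_mul_eq_mul_div, mul_div_assoc,
      ← div_pow]
    gcongr
    rw [inv_le_comm₀ (by positivity) (by positivity), inv_div]
    linarith
  rw [setOf_minWeight_le]
  refine (measureReal_biUnion_finset_le _ _).trans ((Finset.sum_le_sum fun σ _ => hone σ).trans ?_)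
  rw [Finset.sum_const, Finset.card_univ, Fintype.card_perm, Fintype.card_fin, nsmul_eq_mul,
    ← mul_assoc]
  exact mul_le_mul_of_nonneg_right (factorial_mul_exp_div_pow_le hn) (by positivity)

/-- Each of `k` shared edges contributes `t / N` and each of `2 * m` unshared ones `2 * t / N`,
where `N = n + m` is the size of the union. Only an upper bound `k` on the overlap is needed. -/
lemma expPi_real_two_paths_le {n k m : ℕ} (hn : 1 ≤ n) (hkm : k + m = n) {t : ℝ} (ht : 0 < t)
    (σ τ : Equiv.Perm (Fin n)) (hk : (permEdges σ ∩ permEdges τ).card ≤ k) :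
    (expPi (graph n).edgeSet).real
        ({w | ∑ e ∈ permEdges σ, w e ≤ t} ∩ {w | ∑ e ∈ permEdges τ, w e ≤ t})
      ≤ t ^ (n + m) * 4 ^ m * (Real.exp 1 / (n + m : ℕ)) ^ (n + m) := by
  set N : ℝ := ((n + m : ℕ) : ℝ) with hN
  have hNpos : 0 < N := by rw [hN]; exact_mod_cast (by omega : 0 < n + m)
  set θ := N / (2 * t) with hθ
  have hθpos : 0 < θ := by positivity
  have h := expPi_real_two_sums_le (permEdges σ) (permEdges τ) hθpos.le t
  set k' := (permEdges σ ∩ permEdges τ).card with hk'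
  have c1 : (permEdges σ \ permEdges τ).card = n - k' := by
    rw [Finset.card_sdiff, card_permEdges, Finset.inter_comm]
  have c2 : (permEdges τ \ permEdges σ).card = n - k' := by
    rw [Finset.card_sdiff, card_permEdges]
  rw [c1, c2] at h
  obtain ⟨d, rfl⟩ : ∃ d, k = k' + d := ⟨k - k', by omega⟩
  have e1 : n - k' + (n - k') = 2 * d + 2 * m := by omega
  rw [e1] at h
  -- Replacing a shared edge by two unshared ones lowers the bound, so an overlap `k' < k` is no
  -- worse than `k`.
  have hab : ((1 + θ)⁻¹) ^ 2 ≤ (1 + 2 * θ)⁻¹ := by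
    rw [inv_pow]
    gcongr
    nlinarith
  have ha : (1 + 2 * θ)⁻¹ ≤ t / N := by
    rw [inv_le_comm₀ (by positivity) (by positivity), inv_div]
    have : 2 * θ = N / t := by rw [hθ]; field_simp
    rw [this]; linarith
  have hb : (1 + θ)⁻¹ ≤ 2 * t / N := by
    rw [inv_le_comm₀ (by positivity) (by positivity), inv_div]
    linarith
  have hexp : Real.exp (2 * θ * t) = Real.exp 1 ^ (n + m) := by
    rw [Real.exp_one_pow]
    congr 1
    rw [hθ, ← hN]; field_simp
  refine h.trans ?_
  calc Real.exp (2 * θ * t) * (((1 + 2 * θ)⁻¹) ^ k' * ((1 + θ)⁻¹) ^ (2 * d + 2 * m))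
      = Real.exp (2 * θ * t) *
          (((1 + 2 * θ)⁻¹) ^ k' * (((1 + θ)⁻¹ ^ 2) ^ d * ((1 + θ)⁻¹) ^ (2 * m))) := by
        rw [pow_add, pow_mul]
    _ ≤ Real.exp (2 * θ * t) *
          (((1 + 2 * θ)⁻¹) ^ k' * (((1 + 2 * θ)⁻¹) ^ d * ((1 + θ)⁻¹) ^ (2 * m))) := by gcongr
    _ = Real.exp (2 * θ * t) * (((1 + 2 * θ)⁻¹) ^ (k' + d) * ((1 + θ)⁻¹) ^ (2 * m)) := by ring
    _ ≤ Real.exp (2 * θ * t) * ((t / N) ^ (k' + d) * (2 * t / N) ^ (2 * m)) := by gcongr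
    _ = t ^ (n + m) * 4 ^ m * (Real.exp 1 / N) ^ (n + m) := by
        rw [hexp, div_pow, div_pow, div_pow, mul_pow, pow_mul 2 2 m,
          show n + m = k' + d + 2 * m by omega, pow_add t, pow_add N]
        norm_num
        field_simp
        ring

/-- With `m = n - k`, the count contributes `t ^ (k + 1)` and the joint probability `t ^ (n + m)`;
together they give `t ^ (2 * n + 1)` for every `k`. The factorials cancel up to `(n + 1) ^ 4`, and
the sum over `k` adds one more power. -/
lemma sum_card_cuts_le {δ : ℝ} (hδ : 0 < δ) : ∃ C : ℝ, 0 < C ∧ ∀ n : ℕ, 1 ≤ n →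
    ∑ σ : Equiv.Perm (Fin n), ∑ τ : Equiv.Perm (Fin n), (expPi (graph n).edgeSet).real
        ({w | ∑ e ∈ permEdges σ, w e ≤ 1 + δ} ∩ {w | ∑ e ∈ permEdges τ, w e ≤ 1 + δ})
      ≤ C * (n + 1 : ℝ) ^ 5 * (1 + δ) ^ (2 * n) := by
  obtain ⟨C, hC, hcount⟩ := exists_card_permsWithCuts_le hδ
  refine ⟨4 * Real.exp 1 * (1 + δ) * C, by positivity, fun n hn => ?_⟩
  set t := 1 + δ with ht
  have htpos : 0 < t := by linarith
  let J : ℕ → ℝ := fun k => t ^ (n + (n - k)) * 4 ^ (n - k) *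
    (Real.exp 1 / (n + (n - k) : ℕ)) ^ (n + (n - k))
  have hcuts : ∀ ρ : Equiv.Perm (Fin n), (cutsFrom ρ 0).card ≤ n := fun ρ => by
    simpa using Finset.card_le_univ (cutsFrom ρ 0)
  have h1 : ∀ σ τ : Equiv.Perm (Fin n), (expPi (graph n).edgeSet).real
      ({w | ∑ e ∈ permEdges σ, w e ≤ t} ∩ {w | ∑ e ∈ permEdges τ, w e ≤ t})
        ≤ J (cutsFrom (σ⁻¹ * τ) 0).card := fun σ τ =>
    expPi_real_two_paths_le hn (Nat.add_sub_cancel' (hcuts _)) htpos σ τ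
      (card_permEdges_inter_le σ τ)
  have h2 : ∀ σ : Equiv.Perm (Fin n), ∑ τ : Equiv.Perm (Fin n), J (cutsFrom (σ⁻¹ * τ) 0).card
      = ∑ ρ : Equiv.Perm (Fin n), J (cutsFrom ρ 0).card := fun σ =>
    Equiv.sum_comp (Equiv.mulLeft σ⁻¹) fun ρ => J (cutsFrom ρ 0).card
  have h3 : ∑ ρ : Equiv.Perm (Fin n), J (cutsFrom ρ 0).card
      = ∑ k ∈ Finset.range (n + 1), ((permsWithCuts n 0 k).card : ℝ) * J k := by
    rw [← Finset.sum_fiberwise_of_maps_to (t := Finset.range (n + 1))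
      (g := fun ρ : Equiv.Perm (Fin n) => (cutsFrom ρ 0).card)
      fun ρ _ => Finset.mem_range.2 (Nat.lt_succ_iff.2 (hcuts ρ))]
    refine Finset.sum_congr rfl fun k _ => ?_
    rw [Finset.sum_congr rfl (g := fun _ => J k)
      fun ρ hρ => by rw [(Finset.mem_filter.1 hρ).2], Finset.sum_const, nsmul_eq_mul]
    congr 3
    ext ρ
    simp [permsWithCuts]
  have h4 : ∀ k ∈ Finset.range (n + 1), (n.factorial : ℝ) *
      (((permsWithCuts n 0 k).card : ℝ) * J k)
        ≤ 4 * Real.exp 1 * t * C * (n + 1 : ℝ) ^ 4 * t ^ (2 * n) := by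
    intro k hk
    obtain ⟨m, rfl⟩ : ∃ m, n = k + m :=
      ⟨n - k, by have := Finset.mem_range.1 hk; omega⟩
    have h5 := hcount k m
    have h6 := factorial_mul_factorial_le (n := k + m) (m := m) hn (by omega)
    have hm : k + m - k = m := by omega
    simp only [J, hm]
    set E := (Real.exp 1 / (k + m + m : ℕ)) ^ (k + m + m) with hE
    have hEnn : 0 ≤ E := by positivity
    calc ((k + m).factorial : ℝ) * (((permsWithCuts (k + m) 0 k).card : ℝ) *
          (t ^ (k + m + m) * 4 ^ m * E))
        ≤ ((k + m).factorial : ℝ) * ((C * ((m + 1 : ℝ) ^ 2 * m.factorial) * t ^ (k + 1)) *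
          (t ^ (k + m + m) * 4 ^ m * E)) := by gcongr
      _ = C * t * (m + 1 : ℝ) ^ 2 * t ^ (2 * (k + m)) *
          (((k + m).factorial : ℝ) * m.factorial * 4 ^ m * E) := by ring
      _ ≤ C * t * (m + 1 : ℝ) ^ 2 * t ^ (2 * (k + m)) *
          (Real.exp 1 * (k + m + m : ℕ) * (2 * m + 1)) := by gcongr
      _ ≤ C * t * ((k + m : ℕ) + 1 : ℝ) ^ 2 * t ^ (2 * (k + m)) *
          (Real.exp 1 * (2 * ((k + m : ℕ) + 1)) * (2 * ((k + m : ℕ) + 1))) := by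
        gcongr
        · linarith [(Nat.cast_nonneg k : (0 : ℝ) ≤ k)]
        · push_cast; linarith [(Nat.cast_nonneg k : (0 : ℝ) ≤ k)]
        · push_cast; linarith [(Nat.cast_nonneg k : (0 : ℝ) ≤ k)]
      _ = _ := by ring
  calc _ ≤ ∑ σ : Equiv.Perm (Fin n), ∑ τ : Equiv.Perm (Fin n), J (cutsFrom (σ⁻¹ * τ) 0).card :=
        Finset.sum_le_sum fun σ _ => Finset.sum_le_sum fun τ _ => h1 σ τ
    _ = n.factorial * ∑ k ∈ Finset.range (n + 1), ((permsWithCuts n 0 k).card : ℝ) * J k := by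
        simp_rw [h2, h3]
        rw [Finset.sum_const, Finset.card_univ, Fintype.card_perm, Fintype.card_fin, nsmul_eq_mul]
    _ ≤ ∑ k ∈ Finset.range (n + 1), 4 * Real.exp 1 * t * C * (n + 1 : ℝ) ^ 4 * t ^ (2 * n) := by
        rw [Finset.mul_sum]; exact Finset.sum_le_sum h4
    _ = _ := by
        rw [Finset.sum_const, Finset.card_range, nsmul_eq_mul]; push_cast; ring

/-- The second-moment estimate. -/
lemma exists_expPi_real_minWeight_ge {δ : ℝ} (hδ : 0 < δ) : ∃ c : ℝ, 0 < c ∧ ∀ n : ℕ, 1 ≤ n →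
    c / (n + 1 : ℝ) ^ 5 ≤ (expPi (graph n).edgeSet).real {w | minWeight w ≤ 1 + δ} := by
  obtain ⟨C, hC, hV⟩ := sum_card_cuts_le hδ
  refine ⟨Real.exp (-(1 + δ)) ^ 2 / C, by positivity, fun n hn => ?_⟩
  have hmom := sq_sum_measureReal_le (expPi (graph n).edgeSet) Finset.univ
    (fun σ : Equiv.Perm (Fin n) => {w | ∑ e ∈ permEdges σ, w e ≤ 1 + δ})
    fun σ => measurableSet_le (by fun_prop) measurable_const
  rw [← setOf_minWeight_le] at hmom
  set p := (expPi (graph n).edgeSet).real {w | minWeight w ≤ 1 + δ} with hp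
  have hp0 : 0 ≤ p := measureReal_nonneg
  -- The `n!` paths cancel the `n!` in the one-path lower bound.
  have hM : Real.exp (-(1 + δ)) * (1 + δ) ^ n ≤ ∑ σ : Equiv.Perm (Fin n),
      (expPi (graph n).edgeSet).real {w | ∑ e ∈ permEdges σ, w e ≤ 1 + δ} := by
    have h1 : ∀ σ : Equiv.Perm (Fin n), Real.exp (-(1 + δ)) * (1 + δ) ^ n / n.factorial ≤
        (expPi (graph n).edgeSet).real {w | ∑ e ∈ permEdges σ, w e ≤ 1 + δ} := fun σ => by
      have := expPi_real_sum_finset_ge (permEdges σ) (t := 1 + δ) (by linarith)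
      rwa [card_permEdges] at this
    refine le_trans (le_of_eq ?_) (Finset.sum_le_sum fun σ _ => h1 σ)
    rw [Finset.sum_const, Finset.card_univ, Fintype.card_perm, Fintype.card_fin, nsmul_eq_mul]
    have : (n.factorial : ℝ) ≠ 0 := by positivity
    field_simp
  have hpow : 0 < (1 + δ) ^ (2 * n) := by positivity
  have h2 : (Real.exp (-(1 + δ)) * (1 + δ) ^ n) ^ 2
      ≤ p * (C * (n + 1 : ℝ) ^ 5 * (1 + δ) ^ (2 * n)) :=
    calc _ ≤ _ := by gcongr
      _ ≤ _ := hmom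
      _ ≤ _ := by gcongr; exact hV n hn
  have h3 : (Real.exp (-(1 + δ)) * (1 + δ) ^ n) ^ 2
      = Real.exp (-(1 + δ)) ^ 2 * (1 + δ) ^ (2 * n) := by ring
  rw [h3, ← mul_assoc] at h2
  have h4 := le_of_mul_le_mul_right h2 hpow
  rw [div_div, div_le_iff₀ (by positivity)]
  exact h4

/-! ### Amplification: outer edges and disjoint subcubes. -/

/-- Given the first component, a single index `i` with `z.1 ∈ A i` suffices. It depends on that
component only, so `q` is paid once, with no union bound over `i`. -/
lemma prod_forall_imp_le {α β I : Type*} [MeasurableSpace α] [MeasurableSpace β] [Countable I]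
    (μ : Measure α) (ν : Measure β) [IsProbabilityMeasure μ] [IsProbabilityMeasure ν]
    {A : I → Set α} {B : I → Set β} (hA : ∀ i, MeasurableSet (A i))
    (hB : ∀ i, MeasurableSet (B i)) {q : ℝ≥0∞} (hq : ∀ i, ν (B i) ≤ q) :
    (μ.prod ν) {z | ∀ i, z.1 ∈ A i → z.2 ∈ B i} ≤ μ {x | ∀ i, x ∉ A i} + q := by
  have hm : MeasurableSet {z : α × β | ∀ i, z.1 ∈ A i → z.2 ∈ B i} := by
    rw [Set.ofPred_forall]
    refine MeasurableSet.iInter fun i => ?_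
    have : {z : α × β | z.1 ∈ A i → z.2 ∈ B i} = (Prod.fst ⁻¹' A i)ᶜ ∪ Prod.snd ⁻¹' B i := by
      ext z; simp [imp_iff_not_or]
    rw [this]
    exact (measurable_fst (hA i)).compl.union (measurable_snd (hB i))
  have hm' : MeasurableSet {x : α | ∀ i, x ∉ A i} := by
    rw [Set.ofPred_forall]
    exact MeasurableSet.iInter fun i => (hA i).compl
  rw [Measure.prod_apply hm]
  calc _ ≤ ∫⁻ x, ({x : α | ∀ i, x ∉ A i}.indicator 1 x + q) ∂μ := by
        refine lintegral_mono fun x => ?_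
        by_cases hx : ∀ i, x ∉ A i
        · rw [Set.indicator_of_mem (by exact hx)]
          exact prob_le_one.trans le_self_add
        · have hx' := hx
          push Not at hx'
          obtain ⟨i, hi⟩ := hx'
          refine le_trans (measure_mono fun y hy => ?_) ((hq i).trans le_add_self)
          exact hy i hi
    _ = _ := by
        rw [lintegral_add_right _ measurable_const, lintegral_indicator_one hm', lintegral_const,
          measure_univ, mul_one]

/-- The edge in direction `x` at the vertex all of whose coordinates are `c`. -/
def outerEdge {N : ℕ} (z : Fin N × Bool) : (graph N).edgeSet :=
  ⟨s(fun _ => z.2, Function.update (fun _ => z.2) z.1 !z.2), by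
    rw [SimpleGraph.mem_edgeSet]
    change hammingDist _ _ = 1
    rw [hammingDist, Finset.card_eq_one]
    refine ⟨z.1, ?_⟩
    ext j
    by_cases hj : j = z.1 <;> simp [Function.update_apply, hj]⟩

/-- Dimension at least two is essential: in the `1`-cube the edges at the two constant vertices
coincide. -/
lemma outerEdge_injective (n : ℕ) : Function.Injective (outerEdge (N := n + 2)) := by
  rintro ⟨x, c⟩ ⟨x', c'⟩ h
  have h1 := congrArg Subtype.val h
  simp only [outerEdge] at h1
  rw [Sym2.eq_iff] at h1
  rcases h1 with ⟨h1, h2⟩ | ⟨h1, -⟩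
  · have hc : c = c' := congrFun h1 x
    subst hc
    have h3 := congrFun h2 x
    by_cases hx : x = x'
    · rw [hx]
    · simp [hx] at h3
  · obtain ⟨j, hj⟩ := exists_ne x'
    have h3 := congrFun h1 j
    have h4 := congrFun h1 x'
    simp only [Function.update_apply, hj, if_false, if_true] at h3 h4
    rw [h3] at h4
    simp at h4

section Subcube

variable {n : ℕ} (E : Option (Option (Fin n)) ≃ Fin (n + 2))

/-- The embedding of the `n`-cube as the subcube in which the two distinguished coordinates have
the values `b` and `!b`. -/
def subcubeVertex (b : Bool) (v : Vertex n) : Vertex (n + 2) := fun j =>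
  (E.symm j).elim b fun o => o.elim (!b) v

/-- The distinguished coordinate that has the value `true` in the subcube given by `b`. -/
def subcubeCoord (b : Bool) : Fin (n + 2) := if b then E none else E (some none)

lemma subcubeVertex_none (b : Bool) (v : Vertex n) : subcubeVertex E b v (E none) = b := by
  simp [subcubeVertex]

lemma subcubeVertex_some_none (b : Bool) (v : Vertex n) :
    subcubeVertex E b v (E (some none)) = !b := by
  simp [subcubeVertex]

lemma subcubeVertex_some_some (b : Bool) (v : Vertex n) (i : Fin n) :
    subcubeVertex E b v (E (some (some i))) = v i := by
  simp [subcubeVertex]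

lemma subcubeVertex_injective (b : Bool) : Function.Injective (subcubeVertex E b) := by
  intro u v h
  funext i
  rw [← subcubeVertex_some_some E b u, h, subcubeVertex_some_some]

lemma hammingDist_subcubeVertex (b : Bool) (u v : Vertex n) :
    hammingDist (subcubeVertex E b u) (subcubeVertex E b v) = hammingDist u v := by
  simp only [hammingDist, Finset.card_filter]
  rw [← Equiv.sum_comp E, Fintype.sum_option, Fintype.sum_option]
  simp only [subcubeVertex_none, subcubeVertex_some_none, subcubeVertex_some_some]
  simp

/-- The embedding of the `n`-cube as a subcube of codimension two, as a graph homomorphism. -/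
def subcubeHom (b : Bool) : graph n →g graph (n + 2) where
  toFun := subcubeVertex E b
  map_rel' {u v} h := (hammingDist_subcubeVertex E b u v).trans h

/-- The two ends of the subcube are neighbours of the constant vertices of the large cube, which is
why one extra edge at each end suffices. -/
lemma subcubeVertex_const (b c : Bool) : subcubeVertex E b (fun _ => c) =
    Function.update (fun _ => c) (subcubeCoord E (if c then !b else b)) !c := by
  funext j
  obtain ⟨o, rfl⟩ := E.surjective j
  rcases o with _ | _ | i <;> cases b <;> cases c <;>
    simp [subcubeVertex, subcubeCoord]

/-- The edges of the two subcubes given by `E`. -/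
def subcubeEdge (z : Bool × (graph n).edgeSet) : (graph (n + 2)).edgeSet :=
  (subcubeHom E z.1).mapEdgeSet z.2

lemma exists_of_mem_subcubeEdge {z : Bool × (graph n).edgeSet} {u : Vertex (n + 2)}
    (hu : u ∈ (subcubeEdge E z).1) : ∃ v, subcubeVertex E z.1 v = u := by
  obtain ⟨v, -, hv⟩ := Sym2.mem_map.1 hu
  exact ⟨v, hv⟩

/-- Every outer edge contains a constant vertex, and the two distinguished coordinates differ
throughout the subcubes. -/
lemma subcubeEdge_ne_outerEdge (z : Bool × (graph n).edgeSet) (y : Fin (n + 2) × Bool) :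
    outerEdge y ≠ subcubeEdge E z := by
  intro h
  have h1 : (fun _ => y.2) ∈ (subcubeEdge E z).1 := by
    rw [← h]; exact Sym2.mem_mk_left _ _
  obtain ⟨v, hv⟩ := exists_of_mem_subcubeEdge E h1
  have h2 := congrFun hv (E none)
  have h3 := congrFun hv (E (some none))
  rw [subcubeVertex_none] at h2
  rw [subcubeVertex_some_none, h2] at h3
  simp at h3

/-- The subcubes for the two values of `b` are disjoint, so their edge weights are independent. -/
lemma subcubeEdge_injective : Function.Injective (subcubeEdge E) := by
  rintro ⟨b, e⟩ ⟨b', e'⟩ h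
  have hb : b = b' := by
    obtain ⟨u, hu⟩ : ∃ u, u ∈ (subcubeEdge E (b, e)).1 := by
      induction (subcubeEdge E (b, e)).1 with
      | _ u v => exact ⟨u, Sym2.mem_mk_left _ _⟩
    obtain ⟨v, hv⟩ := exists_of_mem_subcubeEdge E hu
    rw [h] at hu
    obtain ⟨v', hv'⟩ := exists_of_mem_subcubeEdge E hu
    have h2 := congrFun (hv.trans hv'.symm) (E none)
    rwa [subcubeVertex_none, subcubeVertex_none] at h2
  subst hb
  have := SimpleGraph.Hom.mapEdgeSet.injective (subcubeHom E b) (subcubeVertex_injective E b) h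
  exact congrArg (Prod.mk b) this

/-- A path of the subcube, extended by one edge at each end. -/
def extendPath (b : Bool) (p : OrientedPath n) : OrientedPath (n + 2) := by
  refine ⟨Fin.cons (α := fun _ => Vertex (n + 2)) (fun _ => false)
    (Fin.snoc (α := fun _ => Vertex (n + 2)) (fun i => subcubeVertex E b (p.1 i))
      fun _ => true), rfl, ?_, fun i => ?_⟩
  · rw [← Fin.succ_last, Fin.cons_succ, Fin.snoc_last]
  · refine Fin.cases ?_ (fun i => Fin.lastCases ?_ (fun i => ?_) i) i
    · rw [Fin.castSucc_zero, Fin.cons_zero, Fin.cons_succ, Fin.snoc_apply_zero,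
        p.2.1, subcubeVertex_const]
      exact (outerEdge (subcubeCoord E b, false)).2
    · rw [← Fin.succ_castSucc, Fin.cons_succ, Fin.cons_succ, Fin.succ_last, Fin.snoc_last,
        Fin.snoc_castSucc, p.2.2.1, subcubeVertex_const]
      exact ((graph (n + 2)).adj_comm _ _).1 (outerEdge (subcubeCoord E !b, true)).2
    · rw [← Fin.succ_castSucc, Fin.cons_succ, Fin.cons_succ, Fin.succ_castSucc, Fin.snoc_castSucc,
        Fin.snoc_castSucc]
      exact (subcubeHom E b).map_rel' (p.2.2.2 i)

lemma pathWeight_extendPath (b : Bool) (p : OrientedPath n) (w : (graph (n + 2)).edgeSet → ℝ) :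
    pathWeight w (extendPath E b p) = w (outerEdge (subcubeCoord E b, false)) +
      (pathWeight (fun e => w (subcubeEdge E (b, e))) p +
        w (outerEdge (subcubeCoord E !b, true))) := by
  have h1 : (extendPath E b p).edge 0 = outerEdge (subcubeCoord E b, false) := by
    refine Subtype.ext ?_
    simp only [OrientedPath.edge, extendPath, outerEdge]
    rw [Fin.castSucc_zero, Fin.cons_zero, Fin.cons_succ, Fin.snoc_apply_zero,
      p.2.1, subcubeVertex_const]
    rfl
  have h2 : (extendPath E b p).edge (Fin.last n).succ = outerEdge (subcubeCoord E !b, true) := by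
    refine Subtype.ext ?_
    simp only [OrientedPath.edge, extendPath, outerEdge]
    rw [← Fin.succ_castSucc, Fin.cons_succ, Fin.cons_succ, Fin.succ_last, Fin.snoc_last,
        Fin.snoc_castSucc, p.2.2.1, subcubeVertex_const, Sym2.eq_swap]
    rfl
  have h3 : ∀ i : Fin n, (extendPath E b p).edge i.castSucc.succ
      = subcubeEdge E (b, p.edge i) := fun i => by
    refine Subtype.ext ?_
    simp only [OrientedPath.edge, extendPath]
    rw [← Fin.succ_castSucc, Fin.cons_succ, Fin.cons_succ, Fin.succ_castSucc, Fin.snoc_castSucc,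
        Fin.snoc_castSucc]
    rfl
  unfold pathWeight
  rw [Fin.sum_univ_succ, Fin.sum_univ_castSucc, h1, h2]
  simp_rw [h3]

lemma minWeight_le_extend (b : Bool) (w : (graph (n + 2)).edgeSet → ℝ) :
    minWeight w ≤ w (outerEdge (subcubeCoord E b, false)) +
      (minWeight (fun e => w (subcubeEdge E (b, e))) +
        w (outerEdge (subcubeCoord E !b, true))) := by
  obtain ⟨p, hp⟩ := exists_minWeight_eq fun e => w (subcubeEdge E (b, e))
  rw [hp, ← pathWeight_extendPath]
  exact minWeight_le _ _

end Subcube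

lemma exists_subcubeCoord_eq (n : ℕ) {x y : Fin (n + 2)} (hxy : x ≠ y) :
    ∃ E : Option (Option (Fin n)) ≃ Fin (n + 2),
      ∀ b, subcubeCoord E b = if b then x else y := by
  obtain ⟨E₀⟩ : Nonempty (Option (Option (Fin n)) ≃ Fin (n + 2)) :=
    ⟨Fintype.equivOfCardEq (by simp)⟩
  set a := E₀ none with ha
  set c := E₀ (some none) with hc
  have hac : a ≠ c := fun h => by simpa using E₀.injective h
  have hx : x ≠ Equiv.swap a x c := fun h =>
    hac ((Equiv.swap a x).injective ((Equiv.swap_apply_left a x).trans h))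
  refine ⟨E₀.trans ((Equiv.swap a x).trans (Equiv.swap (Equiv.swap a x c) y)), fun b => ?_⟩
  cases b
  · simp [subcubeCoord, ← hc]
  · simp only [subcubeCoord, if_true, Equiv.trans_apply, ← ha, Equiv.swap_apply_left]
    exact Equiv.swap_apply_of_ne_of_ne hx hxy

/-! ### The recursion for the tail probability. -/

/-- The probability that all paths of the `n`-cube have a weight exceeding `t`. -/
noncomputable def tailProb (n : ℕ) (t : ℝ) : ℝ≥0∞ :=
  expPi (graph n).edgeSet {w | t < minWeight w}

/-- The first term bounds the event that none of the `(n + 2) / 2` disjoint pairs of coordinates has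
its four outer edges of weight at most `s`. Otherwise such a pair is chosen by looking at outer
edges only, and both its subcubes, independent of these edges and of each other, must have minimal
weight above `t`. -/
lemma tailProb_add_two_le (n : ℕ) (t : ℝ) {s : ℝ} (hs : 0 ≤ s) :
    tailProb (n + 2) (t + 2 * s) ≤
      (1 - ENNReal.ofReal (1 - Real.exp (-s)) ^ 4) ^ ((n + 2) / 2) + tailProb n t ^ 2 := by
  classical
  set h := (n + 2) / 2 with hh
  let coord : Fin h → Bool → Fin (n + 2) := fun i b =>
    if b then ⟨2 * i.val, by omega⟩ else ⟨2 * i.val + 1, by omega⟩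
  have hcoord : Function.Injective fun z : Fin h × Bool => coord z.1 z.2 := by
    rintro ⟨i, b⟩ ⟨i', b'⟩ hz
    cases b <;> cases b' <;> simp [coord, Fin.ext_iff] at hz ⊢ <;> omega
  have hE : ∀ i, ∃ E : Option (Option (Fin n)) ≃ Fin (n + 2),
      ∀ b, subcubeCoord E b = coord i b := fun i =>
    exists_subcubeCoord_eq n (by simp [Fin.ext_iff])
  choose E hE using hE
  -- Splitting the weights into outer and other edges makes the law a product.
  let p : (graph (n + 2)).edgeSet → Prop := fun e => e ∈ Set.range (outerEdge (N := n + 2))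
  let gO : Fin h × (Bool × Bool) → {e // p e} := fun z => ⟨outerEdge (coord z.1 z.2.1, z.2.2), _, rfl⟩
  have hgO : gO.Injective := by
    rintro ⟨i, b, c⟩ ⟨i', b', c'⟩ hz
    have h1 := outerEdge_injective n (congrArg Subtype.val hz)
    rw [Prod.mk.injEq] at h1
    have h2 := hcoord (a₁ := (i, b)) (a₂ := (i', b')) h1.1
    rw [Prod.mk.injEq] at h2
    have h3 := h1.2
    simp only at h3
    rw [h2.1, h2.2, h3]
  let gI : Fin h → Bool × (graph n).edgeSet → {e // ¬ p e} := fun i z =>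
    ⟨subcubeEdge (E i) z, by
      rintro ⟨y, hy⟩; exact subcubeEdge_ne_outerEdge (E i) z y hy⟩
  have hgI : ∀ i, (gI i).Injective := fun i z z' hz =>
    subcubeEdge_injective (E i) (congrArg Subtype.val hz)
  let S : Set (Bool × Bool → ℝ) := {u | ∀ k, u k ≤ s}
  have hS : MeasurableSet S := by
    simp only [S, Set.ofPred_forall]
    exact MeasurableSet.iInter fun k => measurableSet_le (by fun_prop) measurable_const
  let T : Set ((graph n).edgeSet → ℝ) := {w | t < minWeight w}
  have hT : MeasurableSet T := measurableSet_lt measurable_const (measurable_minWeight n)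
  let A : Fin h → Set ({e // p e} → ℝ) := fun i => {u | (fun k => u (gO (i, k))) ∈ S}
  have hA : ∀ i, MeasurableSet (A i) := fun i =>
    measurableSet_preimage (f := fun (u : {e // p e} → ℝ) k => u (gO (i, k))) (by fun_prop) hS
  let T2 : Set (Bool × (graph n).edgeSet → ℝ) := {v | ∀ b, (fun e => v (b, e)) ∈ T}
  have hT2 : MeasurableSet T2 := by
    simp only [T2, Set.ofPred_forall]
    exact MeasurableSet.iInter fun b =>
      measurableSet_preimage (f := fun (v : Bool × (graph n).edgeSet → ℝ) e => v (b, e))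
        (by fun_prop) hT
  let B : Fin h → Set ({e // ¬ p e} → ℝ) := fun i => (fun v z => v (gI i z)) ⁻¹' T2
  have hB : ∀ i, MeasurableSet (B i) := fun i => measurableSet_preimage (by fun_prop) hT2
  have hBq : ∀ i, expPi {e // ¬ p e} (B i) ≤ tailProb n t ^ 2 := fun i => by
    rw [(measurePreserving_expPi_comp (hgI i)).measure_preimage hT2.nullMeasurableSet,
      expPi_blocks hT]
    rfl
  have hAm : expPi {e // p e} {u | ∀ i, u ∉ A i}
      = (1 - ENNReal.ofReal (1 - Real.exp (-s)) ^ 4) ^ h := by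
    have hms : MeasurableSet {u : Fin h × (Bool × Bool) → ℝ | ∀ i, (fun k => u (i, k)) ∈ Sᶜ} := by
      rw [Set.ofPred_forall]
      exact MeasurableSet.iInter fun i =>
        measurableSet_preimage (f := fun (u : Fin h × (Bool × Bool) → ℝ) k => u (i, k))
          (by fun_prop) hS.compl
    have h1 := (measurePreserving_expPi_comp hgO).measure_preimage hms.nullMeasurableSet
    rw [expPi_blocks hS.compl, prob_compl_eq_one_sub hS, expPi_forall_le hs, Fintype.card_fin,
      Fintype.card_prod, Fintype.card_bool] at h1
    exact h1
  have hmp := measurePreserving_piEquivPiSubtypeProd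
    (fun _ : (graph (n + 2)).edgeSet => expMeasure 1) p
  have hsub : {w : (graph (n + 2)).edgeSet → ℝ | t + 2 * s < minWeight w} ⊆
      MeasurableEquiv.piEquivPiSubtypeProd (fun _ => ℝ) p ⁻¹'
        {z | ∀ i, z.1 ∈ A i → z.2 ∈ B i} := by
    intro w hw i hi b
    have hw' : t + 2 * s < minWeight w := hw
    have h1 := minWeight_le_extend (E i) b w
    rw [hE, hE] at h1
    have h2 : w (outerEdge (coord i b, false)) ≤ s := hi (b, false)
    have h3 : w (outerEdge (coord i !b, true)) ≤ s := hi (!b, true)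
    change t < minWeight fun e => w (subcubeEdge (E i) (b, e))
    linarith
  have hfin := prod_forall_imp_le (expPi {e // p e}) (expPi {e // ¬ p e}) hA hB hBq
  rw [hAm] at hfin
  refine (measure_mono hsub).trans ?_
  rw [expPi, hmp.measure_preimage_equiv]
  refine le_trans (le_of_eq ?_) hfin
  congr 2
  unfold expPi
  congr!

lemma tailProb_le_one (n : ℕ) (t : ℝ) : tailProb n t ≤ 1 := prob_le_one

lemma toReal_tailProb_le_one (n : ℕ) (t : ℝ) : (tailProb n t).toReal ≤ 1 :=
  ENNReal.toReal_le_of_le_ofReal zero_le_one (by simpa using tailProb_le_one n t)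

lemma toReal_tailProb_add_two_le (n : ℕ) (t : ℝ) {s : ℝ} (hs : 0 ≤ s) (hs1 : s ≤ 1) :
    (tailProb (n + 2) (t + 2 * s)).toReal ≤
      (1 - (s / 2) ^ 4) ^ ((n + 2) / 2) + (tailProb n t).toReal ^ 2 := by
  have hexp : s / 2 ≤ 1 - Real.exp (-s) := by
    have h2 : Real.exp (-s) ≤ 1 / (1 + s) := by
      rw [Real.exp_neg, ← one_div]
      exact one_div_le_one_div_of_le (by linarith) (by linarith [Real.add_one_le_exp s])
    have h3 : 1 / (1 + s) ≤ 1 - s / 2 := by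
      rw [div_le_iff₀ (by linarith)]; nlinarith
    linarith
  have hle : 1 - Real.exp (-s) ≤ 1 := by linarith [Real.exp_pos (-s)]
  have h := tailProb_add_two_le n t hs
  have h2 : ∀ u : ℝ, 0 ≤ u → u ≤ 1 →
      (1 - ENNReal.ofReal u ^ 4) ^ ((n + 2) / 2) + tailProb n t ^ 2
        = ENNReal.ofReal ((1 - u ^ 4) ^ ((n + 2) / 2) + (tailProb n t).toReal ^ 2) := by
    intro u h0 hu1
    have h4 : u ^ 4 ≤ 1 := pow_le_one₀ h0 hu1
    rw [ENNReal.ofReal_add (pow_nonneg (by linarith) _) (by positivity),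
      ENNReal.ofReal_pow (by linarith), ENNReal.ofReal_sub _ (by positivity), ENNReal.ofReal_one,
      ENNReal.ofReal_pow h0, ENNReal.ofReal_pow ENNReal.toReal_nonneg, ENNReal.ofReal_toReal]
    exact ne_top_of_le_ne_top ENNReal.one_ne_top (tailProb_le_one n t)
  rw [h2 _ (by linarith) hle] at h
  have h5 : (s / 2) ^ 4 ≤ (1 - Real.exp (-s)) ^ 4 := by gcongr
  have h6 : (1 - Real.exp (-s)) ^ 4 ≤ 1 := pow_le_one₀ (by linarith) hle
  have h7 : (1 - (1 - Real.exp (-s)) ^ 4) ^ ((n + 2) / 2) ≤ (1 - (s / 2) ^ 4) ^ ((n + 2) / 2) := by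
    gcongr
  have h8 := pow_nonneg (by linarith : 0 ≤ 1 - (1 - Real.exp (-s)) ^ 4) ((n + 2) / 2)
  exact (ENNReal.toReal_le_of_le_ofReal (by positivity) h).trans (by linarith)

/-- Iteration of `r ↦ r ^ 2 + d`; the error `e` becomes `2 * e + d`, hence the factor `2 ^ j - 1`.
-/
lemma toReal_tailProb_iterate_le (n : ℕ) (t : ℝ) {s : ℝ} (hs : 0 ≤ s) (hs1 : s ≤ 1) (j : ℕ) :
    (tailProb (n + 2 * j) (t + 2 * s * j)).toReal ≤
      (tailProb n t).toReal ^ 2 ^ j + (2 ^ j - 1) * (1 - (s / 2) ^ 4) ^ (n / 2) := by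
  have hb0 : 0 ≤ 1 - (s / 2) ^ 4 := by
    have := pow_le_one₀ (n := 4) (by linarith : 0 ≤ s / 2) (by linarith)
    linarith
  have hb1 : 1 - (s / 2) ^ 4 ≤ 1 := by linarith [pow_nonneg (by linarith : 0 ≤ s / 2) 4]
  induction j with
  | zero => simp
  | succ j ih =>
    have h1 := toReal_tailProb_add_two_le (n + 2 * j) (t + 2 * s * j) hs hs1
    have h2 : (1 - (s / 2) ^ 4) ^ ((n + 2 * j + 2) / 2) ≤ (1 - (s / 2) ^ 4) ^ (n / 2) :=
      pow_le_pow_of_le_one hb0 hb1 (by omega)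
    rw [show n + 2 * j + 2 = n + 2 * (j + 1) by ring,
      show t + 2 * s * j + 2 * s = t + 2 * s * ((j + 1 : ℕ) : ℝ) by push_cast; ring] at h1
    rw [show n + 2 * j + 2 = n + 2 * (j + 1) by ring] at h2
    set r := (tailProb (n + 2 * j) (t + 2 * s * j)).toReal
    set d := (1 - (s / 2) ^ 4) ^ (n / 2)
    have hd : 0 ≤ d := pow_nonneg hb0 _
    set a := (tailProb n t).toReal ^ 2 ^ j with ha
    have ha0 : 0 ≤ a := by positivity
    have ha1 : a ≤ 1 := pow_le_one₀ ENNReal.toReal_nonneg (toReal_tailProb_le_one n t)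
    have hr0 : 0 ≤ r := ENNReal.toReal_nonneg
    have hr1 : r ≤ 1 := toReal_tailProb_le_one _ _
    have hpow : (1 : ℝ) ≤ 2 ^ j := one_le_pow₀ one_le_two
    have he : 0 ≤ (2 ^ j - 1) * d := mul_nonneg (by linarith) hd
    -- Since `r` and `a` are at most `1`, squaring at most doubles their difference.
    have h3 : r ^ 2 ≤ a ^ 2 + 2 * ((2 ^ j - 1) * d) := by
      rcases le_or_gt r a with h | h
      · have : r ^ 2 ≤ a ^ 2 := by gcongr
        linarith
      · have : (r - a) * (r + a) ≤ ((2 ^ j - 1) * d) * 2 :=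
          mul_le_mul (by linarith) (by linarith) (by linarith) he
        nlinarith
    have h4 : (tailProb n t).toReal ^ 2 ^ (j + 1) = a ^ 2 := by
      rw [ha, ← pow_mul, pow_succ]
    rw [h4, pow_succ (2 : ℝ) j]
    linarith

/-! ### Asymptotics of the iteration. -/

/-- The integer part of the eighth root. -/
def eighthRoot (N : ℕ) : ℕ := N.sqrt.sqrt.sqrt

lemma eighthRoot_pow_le (N : ℕ) : eighthRoot N ^ 8 ≤ N := by
  have h1 := Nat.sqrt_le' N.sqrt.sqrt
  have h2 := Nat.sqrt_le' N.sqrt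
  have h3 := Nat.sqrt_le' N
  calc eighthRoot N ^ 8 = ((N.sqrt.sqrt.sqrt ^ 2) ^ 2) ^ 2 := by rw [eighthRoot]; ring
    _ ≤ (N.sqrt.sqrt ^ 2) ^ 2 := by gcongr
    _ ≤ N.sqrt ^ 2 := by gcongr
    _ ≤ N := h3

lemma le_eighthRoot {b N : ℕ} (h : b ^ 8 ≤ N) : b ≤ eighthRoot N := by
  rw [eighthRoot, Nat.le_sqrt', Nat.le_sqrt', Nat.le_sqrt', ← pow_mul, ← pow_mul]
  exact h

lemma lt_eighthRoot_add_one_pow (N : ℕ) : N < (eighthRoot N + 1) ^ 8 := by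
  by_contra! h
  exact absurd (le_eighthRoot h) (by omega)

lemma tendsto_eighthRoot : Tendsto eighthRoot atTop atTop :=
  tendsto_atTop.2 fun b => (eventually_ge_atTop (b ^ 8)).mono fun _ h => le_eighthRoot h

lemma tendsto_two_pow_mul_exp_neg {a : ℝ} (ha : 0 < a) :
    Tendsto (fun k : ℕ => (2 : ℝ) ^ k * Real.exp (-(a * k ^ 2))) atTop (𝓝 0) := by
  have h1 : Tendsto (fun k : ℕ => (1 / 2 : ℝ) ^ k) atTop (𝓝 0) :=
    tendsto_pow_atTop_nhds_zero_of_lt_one (by norm_num) (by norm_num)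
  refine squeeze_zero' (Eventually.of_forall fun k => by positivity) ?_ h1
  obtain ⟨K, hK⟩ := exists_nat_ge (2 / a)
  filter_upwards [eventually_ge_atTop K] with k hk
  -- Then `exp (-(a * k)) ≤ exp (-2) ≤ 1 / 4`, and the `k`-th power beats `2 ^ k`.
  have h2 : 2 ≤ a * k := by
    rw [div_le_iff₀ ha] at hK
    have : (K : ℝ) ≤ k := by exact_mod_cast hk
    nlinarith
  have h3 : Real.exp (-(a * k)) ≤ 1 / 4 := by
    have h4 : Real.exp (-(a * k)) ≤ Real.exp (-1) * Real.exp (-1) := by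
      rw [← Real.exp_add]; exact Real.exp_le_exp.2 (by linarith)
    have h5 : Real.exp (-1) ≤ 1 / 2 := by
      rw [Real.exp_neg, ← one_div]
      exact one_div_le_one_div_of_le (by norm_num) (by linarith [Real.add_one_le_exp (1 : ℝ)])
    nlinarith [Real.exp_pos (-1)]
  have h6 : Real.exp (-(a * k ^ 2)) = Real.exp (-(a * k)) ^ k := by
    rw [← Real.exp_nat_mul]; congr 1; ring
  rw [h6, ← mul_pow]
  gcongr
  linarith

/-- After `k` doublings the exponent `2 ^ k` overwhelms the polynomial `(k + 1) ^ 40`, which bounds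
`(n + 1) ^ 5`. The accumulated error is of order `2 ^ k * exp (-(s / 2) ^ 4 * k ^ 6)` with `s` of
order `1 / k`, so `k ^ 2` in the exponent wins over `2 ^ k`. -/
lemma toReal_tailProb_le_exp {c ε : ℝ} (hε : 0 < ε) (hc : 0 < c)
    (h : ∀ n : ℕ, 1 ≤ n → (tailProb n (1 + ε / 2)).toReal ≤ 1 - c / (n + 1 : ℝ) ^ 5)
    {N k : ℕ} (hk : 2 ≤ k) (hεk : ε ≤ k) (h1 : k ^ 8 ≤ N) (h2 : N < (k + 1) ^ 8) :
    (tailProb N (1 + ε)).toReal ≤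
      2 / c * (((k + 1 : ℕ) : ℝ) ^ 40 / 2 ^ (k + 1)) +
        2 ^ k * Real.exp (-((ε / 8) ^ 4 * k ^ 2)) := by
  have hkpos : (0 : ℝ) < k := by exact_mod_cast (by omega : 0 < k)
  have hN : 2 * k ^ 6 + 2 * k ≤ N := by
    refine le_trans ?_ h1
    have h3 : 1 ≤ k ^ 5 := Nat.one_le_pow _ _ (by omega)
    have h4 : 4 ≤ k ^ 2 := by nlinarith
    calc 2 * k ^ 6 + 2 * k ≤ 2 * k ^ 6 + 2 * (k * k ^ 5) := by nlinarith
      _ = 4 * k ^ 6 := by ring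
      _ ≤ k ^ 2 * k ^ 6 := Nat.mul_le_mul_right _ h4
      _ = k ^ 8 := by ring
  obtain ⟨n, rfl⟩ : ∃ n, N = n + 2 * k := ⟨N - 2 * k, by omega⟩
  have hn : 2 * k ^ 6 ≤ n := by omega
  have hn1 : 1 ≤ n := by
    have : 1 ≤ k ^ 6 := Nat.one_le_pow _ _ (by omega)
    omega
  -- The `k` rounds cost `2 * s * k = ε / 2` in total.
  set s := ε / (4 * k) with hs
  have hs0 : 0 ≤ s := by positivity
  have hs1 : s ≤ 1 := by rw [hs, div_le_one (by positivity)]; linarith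
  have hit := toReal_tailProb_iterate_le n (1 + ε / 2) hs0 hs1 k
  have ht : 1 + ε / 2 + 2 * s * k = 1 + ε := by rw [hs]; field_simp; ring
  rw [ht] at hit
  refine hit.trans (add_le_add ?_ ?_)
  · set x := c / (n + 1 : ℝ) ^ 5 with hx
    have hxpos : 0 < x := by positivity
    have hxk : c / ((k + 1 : ℕ) : ℝ) ^ 40 ≤ x := by
      rw [hx, show 40 = 8 * 5 by norm_num, pow_mul]
      gcongr
      have : n + 1 ≤ (k + 1) ^ 8 := by omega
      exact_mod_cast this
    have hpos : 0 < c / ((k + 1 : ℕ) : ℝ) ^ 40 * 2 ^ k := by positivity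
    calc (tailProb n (1 + ε / 2)).toReal ^ 2 ^ k ≤ (1 - x) ^ 2 ^ k := by
          gcongr; exact h n hn1
      _ ≤ Real.exp (-x) ^ 2 ^ k := by
          gcongr
          · exact ENNReal.toReal_nonneg.trans (h n hn1)
          · exact Real.one_sub_le_exp_neg x
      _ = Real.exp (-(x * 2 ^ k)) := by
          rw [← Real.exp_nat_mul]; congr 1; push_cast; ring
      _ ≤ Real.exp (-(c / ((k + 1 : ℕ) : ℝ) ^ 40 * 2 ^ k)) := by gcongr
      _ ≤ 1 / (c / ((k + 1 : ℕ) : ℝ) ^ 40 * 2 ^ k) := by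
          rw [Real.exp_neg, ← one_div]
          exact one_div_le_one_div_of_le hpos
            (by linarith [Real.add_one_le_exp (c / ((k + 1 : ℕ) : ℝ) ^ 40 * 2 ^ k)])
      _ = _ := by rw [pow_succ 2 k]; field_simp
  · have hd : (1 - (s / 2) ^ 4) ^ (n / 2) ≤ Real.exp (-((ε / 8) ^ 4 * k ^ 2)) := by
      have hb0 : 0 ≤ 1 - (s / 2) ^ 4 := by
        have := pow_le_one₀ (n := 4) (by linarith : 0 ≤ s / 2) (by linarith)
        linarith
      have hb1 : 1 - (s / 2) ^ 4 ≤ 1 := by linarith [pow_nonneg (by linarith : 0 ≤ s / 2) 4]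
      calc (1 - (s / 2) ^ 4) ^ (n / 2) ≤ (1 - (s / 2) ^ 4) ^ (k ^ 6) :=
            pow_le_pow_of_le_one hb0 hb1 (by omega)
        _ ≤ Real.exp (-(s / 2) ^ 4) ^ (k ^ 6) := by
            gcongr; exact Real.one_sub_le_exp_neg _
        _ = Real.exp (-((ε / 8) ^ 4 * k ^ 2)) := by
            rw [← Real.exp_nat_mul]
            congr 1
            push_cast
            rw [hs]
            field_simp
            norm_num
    have hd0 : 0 ≤ (1 - (s / 2) ^ 4) ^ (n / 2) := by
      refine pow_nonneg ?_ _
      have := pow_le_one₀ (n := 4) (by linarith : 0 ≤ s / 2) (by linarith)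
      linarith
    calc (2 ^ k - 1) * (1 - (s / 2) ^ 4) ^ (n / 2) ≤ 2 ^ k * (1 - (s / 2) ^ 4) ^ (n / 2) := by
          gcongr; linarith
      _ ≤ _ := by gcongr

lemma tendsto_tailProb {ε : ℝ} (hε : 0 < ε) :
    Tendsto (fun N => (tailProb N (1 + ε)).toReal) atTop (𝓝 0) := by
  obtain ⟨c, hc, h⟩ := exists_expPi_real_minWeight_ge (half_pos hε)
  have h' : ∀ n : ℕ, 1 ≤ n → (tailProb n (1 + ε / 2)).toReal ≤ 1 - c / (n + 1 : ℝ) ^ 5 := by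
    intro n hn
    have hm : MeasurableSet {w : (graph n).edgeSet → ℝ | minWeight w ≤ 1 + ε / 2} :=
      measurableSet_le (measurable_minWeight n) measurable_const
    have h1 := probReal_compl_eq_one_sub (μ := expPi (graph n).edgeSet) hm
    have h2 : {w : (graph n).edgeSet → ℝ | minWeight w ≤ 1 + ε / 2}ᶜ
        = {w | 1 + ε / 2 < minWeight w} := by ext w; simp
    rw [h2] at h1
    have h3 := h n hn
    rw [tailProb, ← measureReal_def, h1]
    linarith
  have hlim : Tendsto (fun k : ℕ => 2 / c * (((k + 1 : ℕ) : ℝ) ^ 40 / 2 ^ (k + 1)) +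
      2 ^ k * Real.exp (-((ε / 8) ^ 4 * k ^ 2))) atTop (𝓝 0) := by
    have h1 := ((tendsto_add_atTop_iff_nat 1).2
      (tendsto_pow_const_div_const_pow_of_one_lt 40 (one_lt_two (α := ℝ)))).const_mul (2 / c)
    have h2 := h1.add (tendsto_two_pow_mul_exp_neg (a := (ε / 8) ^ 4) (by positivity))
    simpa using h2
  refine squeeze_zero' (Eventually.of_forall fun N => ENNReal.toReal_nonneg) ?_
    (hlim.comp tendsto_eighthRoot)
  obtain ⟨K, hK⟩ := exists_nat_ge ε
  filter_upwards [tendsto_eighthRoot.eventually_ge_atTop (max 2 K)] with N hN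
  exact toReal_tailProb_le_exp hε hc h' ((le_max_left _ _).trans hN)
    (hK.trans (by exact_mod_cast (le_max_right _ _).trans hN)) (eighthRoot_pow_le N)
    (lt_eighthRoot_add_one_pow N)

lemma tendsto_expPi_minWeight_le {ε : ℝ} (hε : 0 < ε) :
    Tendsto (fun n => (expPi (graph n).edgeSet).real {w | minWeight w ≤ 1 - ε}) atTop (𝓝 0) := by
  -- The maximum keeps `t` positive when `ε ≥ 1`.
  set t := max (1 - ε) (1 / 2) with ht
  have ht0 : 0 < t := lt_of_lt_of_le (by norm_num) (le_max_right _ _)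
  have ht1 : t < 1 := max_lt (by linarith) (by norm_num)
  have hlim : Tendsto (fun n : ℕ => Real.exp 1 * (n * t ^ n)) atTop (𝓝 0) := by
    simpa using (tendsto_self_mul_const_pow_of_lt_one ht0.le ht1).const_mul (Real.exp 1)
  refine squeeze_zero' (Eventually.of_forall fun n => measureReal_nonneg) ?_ hlim
  filter_upwards [eventually_ge_atTop 1] with n hn
  rw [← mul_assoc]
  refine le_trans (measureReal_mono fun w hw => ?_) (expPi_real_minWeight_le hn ht0)
  exact le_trans (b := 1 - ε) hw (le_max_left _ _)

end Hypercube

theorem theorem1 {Ω : ℕ → Type*} [∀ n, MeasurableSpace (Ω n)]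
    (P : ∀ n, Measure (Ω n)) [∀ n, IsProbabilityMeasure (P n)]
    (ξ : ∀ n, (Hypercube.graph n).edgeSet → Ω n → ℝ)
    (hlaw : ∀ n e, HasLaw (ξ n e) (expMeasure 1) (P n))
    (hindep : ∀ n, iIndepFun (ξ n) (P n)) :
    ∀ ε : ℝ, 0 < ε →
      Tendsto (fun n => P n {ω | ε ≤ |Hypercube.minWeight (fun e => ξ n e ω) - 1|})
        atTop (𝓝 0) := by
  intro ε hε
  have hjoint : ∀ n, HasLaw (fun ω e => ξ n e ω)
      (Hypercube.expPi (Hypercube.graph n).edgeSet) (P n) := fun n =>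
    (hindep n).hasLaw_pi (hlaw n)
  have hbound : ∀ n, P n {ω | ε ≤ |Hypercube.minWeight (fun e => ξ n e ω) - 1|} ≤
      ENNReal.ofReal ((Hypercube.expPi (Hypercube.graph n).edgeSet).real
        {w | Hypercube.minWeight w ≤ 1 - ε} + (Hypercube.tailProb n (1 + ε / 2)).toReal) := by
    intro n
    have hm : MeasurableSet {w : (Hypercube.graph n).edgeSet → ℝ |
        ε ≤ |Hypercube.minWeight w - 1|} :=
      measurableSet_le measurable_const ((Hypercube.measurable_minWeight n).sub_const 1).abs
    rw [(hjoint n).measure_eq (p := fun w => ε ≤ |Hypercube.minWeight w - 1|) hm,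
      ENNReal.ofReal_add measureReal_nonneg ENNReal.toReal_nonneg, ofReal_measureReal,
      ENNReal.ofReal_toReal (ne_top_of_le_ne_top ENNReal.one_ne_top
        (Hypercube.tailProb_le_one n _))]
    refine (measure_mono fun w hw => ?_).trans (measure_union_le _ _)
    have hw' : ε ≤ |Hypercube.minWeight w - 1| := hw
    rcases le_abs.1 hw' with h | h
    -- Passing to `ε / 2` turns the weak inequality into the strict one of `tailProb`.
    · exact Or.inr (show 1 + ε / 2 < Hypercube.minWeight w by linarith)
    · exact Or.inl (show Hypercube.minWeight w ≤ 1 - ε by linarith)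
  have hlim := (Hypercube.tendsto_expPi_minWeight_le hε).add
    (Hypercube.tendsto_tailProb (half_pos hε))
  have hlim' := ENNReal.tendsto_ofReal hlim
  rw [add_zero, ENNReal.ofReal_zero] at hlim'
  exact tendsto_of_tendsto_of_tendsto_of_le_of_le tendsto_const_nhds hlim'
    (fun n => zero_le) hbound
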